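/- Let $f:\mathbb{R}\to\mathbb{R}$ be locally Lipschitz. For a bounded domain $\Omega\subset\mathbb{R}^2$ let $u\in C^2(\Omega)\cap C(\overline\Omega)$ be a non-constant solution of $\Delta u+f(u)=0$ in $\Omega$, $u=0$ on $\partial\Omega$, and suppose that $f(u)\ge 0$ in $\Omega$ (for instance, $f\ge 0$). A critical point of $u$ is a point of $\Omega$ at which $\nabla u=0$. (1) Let $0<a<\min(b_1,b_2)$, $b_1\neq b_2$, let $E=\{(x,y):x^2/b_1^2+y^2/b_2^2<1\}$, and let $\Omega=E\setminus\{(x,y):x^2+y^2\le a^2\}$ (the exterior petal-like domain whose interior boundary is the circle of radius $a$ and whose exterior boundary is the concentric ellipse with semi-axes $b_1,b_2$). Let $c$ be the inradius of $E$, i.e. the supremum of the radii of the discs contained in $E$. Then all critical points of $u$ lie in $$\Big\{\Big(-\tfrac{a+b_1}{2},\tfrac{a+b_1}{2}\Big)\times\Big(-\tfrac{a+b_2}{2},\tfrac{a+b_2}{2}\Big)\Big\}\cap\Big\{\Omega\setminus\big\{(x,y):a<\sqrt{x^2+y^2}\le\sqrt{ac}\big\}\Big\}.$$ (2) Let $a>0$,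 $r>0$, $a+r<R$, and let $\Omega=\{(x,y):x^2+y^2<R^2\}\setminus\{(x,y):(x-a)^2+y^2\le r^2\}$ (an eccentric circle annular domain). Then all critical points of $u$ lie in $$\Big\{\Big(\tfrac{-R+a-r}{2},\tfrac{a+r+R}{2}\Big)\times(-R,R)\Big\}\cap\Big\{\Omega\setminus\big\{(x,y):r<\sqrt{(x-a)^2+y^2}\le\sqrt{r(R-a)}\big\}\Big\}.$$ -/

import Mathlib

/-- The Euclidean plane. -/
abbrev Plane : Type := EuclideanSpace ℝ (Fin 2)

/-- `u` is a classical solution of `Δu + f(u) = 0` in `Ω`, `u = 0` on `∂Ω`: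
it is twice continuously differentiable in `Ω` and continuous up to the boundary. -/
structure IsDirichletSolution (f : ℝ → ℝ) (Ω : Set Plane) (u : Plane → ℝ) : Prop where
  contDiffOn : ContDiffOn ℝ 2 u Ω
  continuousOn : ContinuousOn u (closure Ω)
  equation : ∀ p ∈ Ω, Laplacian.laplacian u p + f (u p) = 0
  boundary : ∀ p ∈ frontier Ω, u p = 0

/-- `u` is not constant in `Ω`. -/
def IsNonconstantOn (u : Plane → ℝ) (Ω : Set Plane) : Prop :=
  ∃ p ∈ Ω, ∃ q ∈ Ω, u p ≠ u q

/-- The set of critical points of `u` in `Ω`. -/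
def criticalSet (u : Plane → ℝ) (Ω : Set Plane) : Set Plane :=
  {p | p ∈ Ω ∧ gradient u p = 0}

/-- The open region bounded by the ellipse centred at the origin with semi-axes `b₁`, `b₂`
along the coordinate axes. -/
def ellipseRegion (b₁ b₂ : ℝ) : Set Plane :=
  {p | p 0 ^ 2 / b₁ ^ 2 + p 1 ^ 2 / b₂ ^ 2 < 1}

/-- The inradius of a planar region: the supremum of the radii of the discs contained in it. -/
noncomputable def inradius (D : Set Plane) : ℝ :=
  sSup {ρ : ℝ | ∃ p : Plane, Metric.ball p ρ ⊆ D}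

/-- The exterior petal-like domain whose interior boundary is the circle of radius `a` centred
at the origin and whose exterior boundary is the ellipse with semi-axes `b₁`, `b₂`, of the same
centre. It is used for `0 < a < b₁`, `a < b₂`, `b₁ ≠ b₂`; the exterior boundary is then not a
circle, it is symmetric about exactly two lines, which are perpendicular, and the region it bounds
is convex and smooth, so that all requirements on an exterior petal-like domain hold. -/
def ellipticPetalDomain (a b₁ b₂ : ℝ) : Set Plane :=
  ellipseRegion b₁ b₂ \ Metric.closedBall 0 a

/-- The eccentric circle annular domain between the circle of radius `R` centred at the origin
and the circle of radius `r` centred at `(a, 0)`. It is used for `0 < a`, `0 < r`, `a + r < R`. -/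
def eccentricAnnulus (a r R : ℝ) : Set Plane :=
  Metric.ball 0 R \ Metric.closedBall !₂[a, 0] r

/-- The open box `(x₁, x₂) × (y₁, y₂)`. -/
def openBox (x₁ x₂ y₁ y₂ : ℝ) : Set Plane :=
  {p | p 0 ∈ Set.Ioo x₁ x₂ ∧ p 1 ∈ Set.Ioo y₁ y₂}

/-- The ring of all points whose distance from `z` lies in `(s, t]`. -/
def roundRing (z : Plane) (s t : ℝ) : Set Plane :=
  {p | s < dist p z ∧ dist p z ≤ t}

/-!
The proof is the method of moving planes, run once for lines and once for circles.

Let `T` be the reflection in a mirror (a line, or a circle with inversion), and suppose that `T`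
carries the cap cut off from `Ω` by the mirror into `Ω`. A reflection is conformal with dilation
factor at least `1` in the cap, and its components are harmonic, so in two dimensions
`Δ(u ∘ T) = c² (Δu) ∘ T` with `c ≥ 1`. As `f(u) ≥ 0`, the difference `w = u ∘ T - u` satisfies
`Δw ≤ M |w|` in the cap, where `M` is a Lipschitz constant of `f` on the range of `u`. It vanishes
on the mirror and is nonnegative on the rest of the boundary of the cap, where `u = 0`. Suppose
that `w ≥ 0` in the cap. Then `w > 0` by the strong maximum principle, because some boundary point
is carried into `Ω`; by the boundary point lemma of Hopf the derivative of `w` does not vanish on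
the mirror. But it would vanish at a critical point of `u` on the mirror. Hence the mirrors contain
no critical points (`IsMovingFamily.gradient_ne_zero`).

That `w ≥ 0` holds for every mirror of the family is shown by continuous induction, starting from
the empty cap (`IsMovingFamily.nonneg`). On a compact part of the cap positivity persists under
small motions of the mirror. The rest of the cap is close to its boundary, and there the function
`4 - exp (k (τ - t)) - exp (-k η)` is, for large `k`, a positive strict supersolution which enforces
the maximum principle (`exists_comparison`, `IsMovingFamily.exists_nonneg_of_nonneg_inside`). Here
`{τ = t}` is the mirror and `η` vanishes on the part of the boundary that the caps meet. For both
families `τ` and `η` are quadratic polynomials, so all their derivatives are explicit.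

Lines perpendicular to the axes, moving from the tangent of the outer ellipse towards the hole,
give the box (`isMovingFamily_line`). Circles about the centre of the hole, of radii between `r`
and `√(r c)` where `c` is the radius of a disc inside the ellipse, give the ring
(`isMovingFamily_inversion`): inversion in the circle of radius `ρ` carries the circle of radius `r`
to that of radius `ρ² / r ≤ c`.
-/

namespace MovingPlanes

open Set Filter Topology Laplacian

/-! ### Second-order calculus in the plane -/

theorem laplacian_eq_sum_fderiv_fderiv {F ι : Type*} [NormedAddCommGroup F] [NormedSpace ℝ F]
    [Fintype ι] (b : OrthonormalBasis ι ℝ Plane) (v : Plane → F) (x : Plane) :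
    Δ v x = ∑ i, fderiv ℝ (fderiv ℝ v) x (b i) (b i) := by
  simp [InnerProductSpace.laplacian_eq_iteratedFDeriv_orthonormalBasis v b,
    iteratedFDeriv_two_apply]

theorem laplacian_eq_sum_fderiv {F ι : Type*} [NormedAddCommGroup F] [NormedSpace ℝ F]
    [Fintype ι] (b : OrthonormalBasis ι ℝ Plane) {v : Plane → F} {x : Plane}
    (hv : ContDiffAt ℝ 2 v x) :
    Δ v x = ∑ i, fderiv ℝ (fun y => fderiv ℝ v y (b i)) x (b i) := by
  rw [laplacian_eq_sum_fderiv_fderiv b]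
  refine Finset.sum_congr rfl fun i _ => ?_
  have h : DifferentiableAt ℝ (fderiv ℝ v) x :=
    (hv.fderiv_right (m := 1) (by norm_num)).differentiableAt (by norm_num)
  rw [fderiv_clm_apply h (by fun_prop)]
  simp

/-- The chain rule for second derivatives. -/
theorem fderiv_fderiv_comp {E F G : Type*} [NormedAddCommGroup E] [NormedSpace ℝ E]
    [NormedAddCommGroup F] [NormedSpace ℝ F] [NormedAddCommGroup G] [NormedSpace ℝ G]
    {v : F → G} {T : E → F} {x : E} (hv : ContDiffAt ℝ 2 v (T x)) (hT : ContDiffAt ℝ 2 T x)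
    (h k : E) :
    fderiv ℝ (fderiv ℝ (v ∘ T)) x h k =
      fderiv ℝ (fderiv ℝ v) (T x) (fderiv ℝ T x h) (fderiv ℝ T x k) +
        fderiv ℝ v (T x) (fderiv ℝ (fderiv ℝ T) x h k) := by
  have hv1 : DifferentiableAt ℝ (fderiv ℝ v) (T x) :=
    (hv.fderiv_right (m := 1) (by norm_num)).differentiableAt (by norm_num)
  have hT1 : DifferentiableAt ℝ (fderiv ℝ T) x :=
    (hT.fderiv_right (m := 1) (by norm_num)).differentiableAt (by norm_num)
  have hT0 : DifferentiableAt ℝ T x := hT.differentiableAt (by norm_num)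
  have e : fderiv ℝ (v ∘ T) =ᶠ[𝓝 x] fun y => (fderiv ℝ v (T y)).comp (fderiv ℝ T y) := by
    have h1 : ∀ᶠ y in 𝓝 x, ContDiffAt ℝ 2 T y := hT.eventually (by simp)
    have h2 : ∀ᶠ y in 𝓝 x, ContDiffAt ℝ 2 v (T y) :=
      hT.continuousAt.eventually (hv.eventually (by simp))
    filter_upwards [h1, h2] with y hy1 hy2
    exact fderiv_comp y (hy2.differentiableAt (by norm_num)) (hy1.differentiableAt (by norm_num))
  rw [e.fderiv_eq]
  have := (HasFDerivAt.comp x hv1.hasFDerivAt hT0.hasFDerivAt).clm_comp hT1.hasFDerivAt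
  have h3 := this.fderiv
  simp only [Function.comp_def] at h3
  rw [h3]
  simp [add_comm]

/-- In the plane a conformal change of variables whose components are harmonic multiplies the
Laplacian by the square of its dilation factor. -/
theorem laplacian_comp_conformal {v : Plane → ℝ} {T : Plane → Plane} {x : Plane}
    (hv : ContDiffAt ℝ 2 v (T x)) (hT : ContDiffAt ℝ 2 T x) {c : ℝ} {A : Plane ≃ₗᵢ[ℝ] Plane}
    (hA : ∀ h, fderiv ℝ T x h = c • A h) (hΔ : Δ T x = 0) :
    Δ (v ∘ T) x = c ^ 2 * Δ v (T x) := by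
  let b := EuclideanSpace.basisFun (Fin 2) ℝ
  rw [laplacian_eq_sum_fderiv_fderiv b, laplacian_eq_sum_fderiv_fderiv (b.map A)]
  rw [laplacian_eq_sum_fderiv_fderiv b] at hΔ
  simp only [fderiv_fderiv_comp hv hT, Finset.sum_add_distrib]
  rw [← map_sum, hΔ, map_zero, add_zero, Finset.mul_sum]
  refine Finset.sum_congr rfl fun i _ => ?_
  simp [hA]
  ring

theorem fderiv_apply_eq_inner_gradient (v : Plane → ℝ) (x h : Plane) :
    fderiv ℝ v x h = inner ℝ (gradient v x) h := by
  rw [← toDual_gradient]; simp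

theorem laplacian_comp_real {g : ℝ → ℝ} {ψ : Plane → ℝ} {x : Plane}
    (hg : ContDiffAt ℝ 2 g (ψ x)) (hψ : ContDiffAt ℝ 2 ψ x) :
    Δ (g ∘ ψ) x =
      deriv (deriv g) (ψ x) * ‖gradient ψ x‖ ^ 2 + deriv g (ψ x) * Δ ψ x := by
  let b := EuclideanSpace.basisFun (Fin 2) ℝ
  rw [laplacian_eq_sum_fderiv_fderiv b, laplacian_eq_sum_fderiv_fderiv b]
  simp only [fderiv_fderiv_comp hg hψ, Finset.sum_add_distrib]
  rw [← map_sum, ← OrthonormalBasis.sum_sq_norm_inner_left b, Finset.mul_sum]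
  have hg1 : DifferentiableAt ℝ (fderiv ℝ g) (ψ x) :=
    (hg.fderiv_right (m := 1) (by norm_num)).differentiableAt (by norm_num)
  have h2 : ∀ s t : ℝ, fderiv ℝ (fderiv ℝ g) (ψ x) s t = deriv (deriv g) (ψ x) * (s * t) := by
    intro s t
    have : deriv g = fun y => fderiv ℝ g y 1 := by ext y; simp
    rw [this, ← fderiv_apply_one_eq_deriv, fderiv_clm_apply hg1 (by fun_prop)]
    have e1 : s = s • (1 : ℝ) := by simp
    have e2 : t = t • (1 : ℝ) := by simp
    rw [e1, e2]
    simp only [map_smul, _root_.smul_apply]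
    simp
    ring
  congr 1
  · refine Finset.sum_congr rfl fun i _ => ?_
    rw [h2, fderiv_apply_eq_inner_gradient]
    simp [sq]
  · rw [fderiv_eq_smul_deriv]
    simp [mul_comm]

theorem laplacian_exp_comp {ψ : Plane → ℝ} {x : Plane} (hψ : ContDiffAt ℝ 2 ψ x) :
    Δ (fun y => Real.exp (ψ y)) x = Real.exp (ψ x) * (‖gradient ψ x‖ ^ 2 + Δ ψ x) := by
  have := laplacian_comp_real (g := Real.exp) Real.contDiff_exp.contDiffAt hψ
  simp only [Real.deriv_exp] at this
  rw [mul_add, ← this]; rfl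

/-- At an interior minimum the Laplacian is nonnegative. -/
theorem laplacian_nonneg_of_isLocalMin {v : Plane → ℝ} {x : Plane} (hv : ContDiffAt ℝ 2 v x)
    (hmin : IsLocalMin v x) : 0 ≤ Δ v x := by
  rw [laplacian_eq_sum_fderiv_fderiv (EuclideanSpace.basisFun (Fin 2) ℝ)]
  refine Finset.sum_nonneg fun i _ => ?_
  set e : Plane := EuclideanSpace.basisFun (Fin 2) ℝ i
  let γ : ℝ → Plane := fun t => x + t • e
  have hγ0 : γ 0 = x := by simp [γ]
  have hγ : ∀ t, HasDerivAt γ e t := fun t => by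
    have := ((hasDerivAt_id t).smul_const e).const_add x
    rwa [one_smul] at this
  have hγc : ContinuousAt γ 0 := (hγ 0).continuousAt
  have hγt : Tendsto γ (𝓝 0) (𝓝 x) := by simpa [ContinuousAt, hγ0] using hγc
  have hd1 : ∀ᶠ t in 𝓝 0, HasDerivAt (v ∘ γ) (fderiv ℝ v (γ t) e) t := by
    have h2 : ∀ᶠ y in 𝓝 x, ContDiffAt ℝ 2 v y := hv.eventually (by simp)
    filter_upwards [hγt.eventually h2] with t ht
    exact (ht.differentiableAt (by norm_num)).hasFDerivAt.comp_hasDerivAt t (hγ t)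
  have hv1 : DifferentiableAt ℝ (fderiv ℝ v) x :=
    (hv.fderiv_right (m := 1) (by norm_num)).differentiableAt (by norm_num)
  have hd2 : HasDerivAt (fun t => fderiv ℝ v (γ t) e) (fderiv ℝ (fderiv ℝ v) x e e) 0 := by
    have h1 : HasFDerivAt (fderiv ℝ v) (fderiv ℝ (fderiv ℝ v) x) (γ 0) := by
      rw [hγ0]; exact hv1.hasFDerivAt
    simpa using (h1.comp_hasDerivAt 0 (hγ 0)).clm_apply (hasDerivAt_const 0 e)
  have hdd : deriv (v ∘ γ) =ᶠ[𝓝 0] fun t => fderiv ℝ v (γ t) e := hd1.mono fun t ht => ht.deriv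
  have hdd' : deriv (deriv (v ∘ γ)) 0 = fderiv ℝ (fderiv ℝ v) x e e := by
    rw [hdd.deriv_eq, hd2.deriv]
  have hm : IsLocalMin (v ∘ γ) 0 := by
    have : ∀ᶠ y in 𝓝 x, v x ≤ v y := hmin
    filter_upwards [hγt.eventually this] with t ht
    simpa [hγ0] using ht
  by_contra! hneg
  have hmax : IsLocalMax (v ∘ γ) 0 :=
    isLocalMax_of_deriv_deriv_neg (by rw [hdd']; exact hneg) hm.deriv_eq_zero
      hd1.self_of_nhds.continuousAt
  -- a local minimum that is also a local maximum is locally constant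
  have hc : v ∘ γ =ᶠ[𝓝 0] fun _ => (v ∘ γ) 0 := by
    filter_upwards [hm, hmax] with t h1 h2 using le_antisymm h2 h1
  have : deriv (deriv (v ∘ γ)) 0 = 0 := by
    rw [hc.deriv.deriv_eq]; simp
  linarith

theorem laplacian_smul_sub_const {φ : Plane → ℝ} {x z : Plane} (hφ : ContDiffAt ℝ 2 φ x) :
    Δ (fun y => φ y • (y - z)) x = (2 : ℝ) • gradient φ x + Δ φ x • (x - z) := by
  let b := EuclideanSpace.basisFun (Fin 2) ℝ
  have hφz : ContDiffAt ℝ 2 (fun y => φ y • (y - z)) x := hφ.smul (by fun_prop)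
  rw [laplacian_eq_sum_fderiv b hφz, laplacian_eq_sum_fderiv b hφ]
  have hd : DifferentiableAt ℝ (fderiv ℝ φ) x :=
    (hφ.fderiv_right (m := 1) (by norm_num)).differentiableAt (by norm_num)
  have key : ∀ k : Plane, fderiv ℝ (fun y => fderiv ℝ (fun y => φ y • (y - z)) y k) x k =
      (2 : ℝ) • fderiv ℝ φ x k • k + fderiv ℝ (fun y => fderiv ℝ φ y k) x k • (x - z) := by
    intro k
    have e : (fun y => fderiv ℝ (fun y => φ y • (y - z)) y k) =ᶠ[𝓝 x]
        fun y => φ y • k + fderiv ℝ φ y k • (y - z) := by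
      have h2 : ∀ᶠ y in 𝓝 x, ContDiffAt ℝ 2 φ y := hφ.eventually (by simp)
      filter_upwards [h2] with y hy
      rw [fderiv_fun_smul (hy.differentiableAt (by norm_num)) (by fun_prop)]
      simp [fderiv_sub_const]
    rw [e.fderiv_eq]
    have h1 : DifferentiableAt ℝ φ x := hφ.differentiableAt (by norm_num)
    have h3 : DifferentiableAt ℝ (fun y => fderiv ℝ φ y k) x := by fun_prop
    rw [fderiv_fun_add (by fun_prop) (by fun_prop), fderiv_fun_smul h1 (by fun_prop),
      fderiv_fun_smul h3 (by fun_prop)]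
    simp [fderiv_sub_const, two_smul]
    abel
  simp only [key, Finset.sum_add_distrib, ← Finset.smul_sum, ← Finset.sum_smul]
  congr 2
  conv_rhs => rw [← b.sum_repr' (gradient φ x)]
  refine Finset.sum_congr rfl fun i _ => ?_
  rw [fderiv_apply_eq_inner_gradient, real_inner_comm]

/-! ### Quadratic functions without mixed term -/

/-- The quadratic function `A p₀² + B p₁² + C p₀ + D p₁ + c` on the plane. -/
def quad (A B C D c : ℝ) (p : Plane) : ℝ :=
  A * p 0 ^ 2 + B * p 1 ^ 2 + C * p 0 + D * p 1 + c

theorem contDiff_quad (A B C D c : ℝ) {n : WithTop ℕ∞} : ContDiff ℝ n (quad A B C D c) := by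
  unfold quad; fun_prop

theorem hasFDerivAt_quad (A B C D c : ℝ) (x : Plane) :
    HasFDerivAt (quad A B C D c)
      ((2 * A * x 0 + C) • (EuclideanSpace.proj 0 : Plane →L[ℝ] ℝ) +
        (2 * B * x 1 + D) • (EuclideanSpace.proj 1 : Plane →L[ℝ] ℝ)) x := by
  have h0 : HasFDerivAt (fun p : Plane => p 0) (EuclideanSpace.proj 0 : Plane →L[ℝ] ℝ) x :=
    (EuclideanSpace.proj 0 : Plane →L[ℝ] ℝ).hasFDerivAt
  have h1 : HasFDerivAt (fun p : Plane => p 1) (EuclideanSpace.proj 1 : Plane →L[ℝ] ℝ) x :=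
    (EuclideanSpace.proj 1 : Plane →L[ℝ] ℝ).hasFDerivAt
  have := (((((h0.pow 2).const_mul A).add ((h1.pow 2).const_mul B)).add (h0.const_mul C)).add
    (h1.const_mul D)).add_const c
  refine this.congr_fderiv ?_
  ext p
  simp
  ring

theorem fderiv_quad_apply (A B C D c : ℝ) (x k : Plane) :
    fderiv ℝ (quad A B C D c) x k = (2 * A * x 0 + C) * k 0 + (2 * B * x 1 + D) * k 1 := by
  rw [(hasFDerivAt_quad A B C D c x).fderiv]; simp

theorem gradient_quad (A B C D c : ℝ) (x : Plane) :
    gradient (quad A B C D c) x = !₂[2 * A * x 0 + C, 2 * B * x 1 + D] := by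
  refine ext_inner_right ℝ fun k => ?_
  rw [← fderiv_apply_eq_inner_gradient, fderiv_quad_apply]
  simp [PiLp.inner_apply, Fin.sum_univ_two]
  ring

theorem norm_gradient_quad_sq (A B C D c : ℝ) (x : Plane) :
    ‖gradient (quad A B C D c) x‖ ^ 2 = (2 * A * x 0 + C) ^ 2 + (2 * B * x 1 + D) ^ 2 := by
  simp [gradient_quad, EuclideanSpace.norm_sq_eq, Fin.sum_univ_two]

theorem laplacian_quad (A B C D c : ℝ) (x : Plane) :
    Δ (quad A B C D c) x = 2 * A + 2 * B := by
  rw [laplacian_eq_sum_fderiv (EuclideanSpace.basisFun (Fin 2) ℝ)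
    (contDiff_quad A B C D c).contDiffAt]
  have : ∀ i : Fin 2, (fun y => fderiv ℝ (quad A B C D c) y
      (EuclideanSpace.basisFun (Fin 2) ℝ i)) = if i = 0 then quad 0 0 (2 * A) 0 C
        else quad 0 0 0 (2 * B) D := by
    intro i
    ext y
    fin_cases i <;> simp [fderiv_quad_apply, quad]
  simp [Fin.sum_univ_two, -EuclideanSpace.basisFun_apply, this]
  simp [fderiv_quad_apply]

theorem norm_sub_sq_eq_quad (x z : Plane) :
    ‖x - z‖ ^ 2 = quad 1 1 (-2 * z 0) (-2 * z 1) (z 0 ^ 2 + z 1 ^ 2) x := by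
  simp [EuclideanSpace.norm_sq_eq, Fin.sum_univ_two, quad]
  ring

/-- The inversion of the plane in a circle has harmonic components. -/
theorem laplacian_inversion {z x : Plane} (hx : x ≠ z) (ρ : ℝ) :
    Δ (EuclideanGeometry.inversion z ρ) x = 0 := by
  let ψ := quad 1 1 (-2 * z 0) (-2 * z 1) (z 0 ^ 2 + z 1 ^ 2)
  have hψ : ∀ y, ψ y = ‖y - z‖ ^ 2 := fun y => (norm_sub_sq_eq_quad y z).symm
  let g : ℝ → ℝ := fun t => ρ ^ 2 * t⁻¹
  have hne : ψ x ≠ 0 := by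
    rw [hψ]; simpa [sub_eq_zero] using hx
  have hψc : ContDiffAt ℝ 2 ψ x := (contDiff_quad ..).contDiffAt
  have hg : ContDiffAt ℝ 2 g (ψ x) := contDiffAt_const.mul (contDiffAt_inv ℝ hne)
  have hgψ : ContDiffAt ℝ 2 (g ∘ ψ) x := hg.comp x hψc
  have e : EuclideanGeometry.inversion z ρ = (fun y => (g ∘ ψ) y • (y - z)) + fun _ => z := by
    ext1 y
    simp [EuclideanGeometry.inversion, g, hψ, dist_eq_norm, div_eq_mul_inv, mul_pow]
  have hsm : ContDiffAt ℝ 2 (fun y => (g ∘ ψ) y • (y - z)) x := hgψ.smul (by fun_prop)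
  have g1 : ∀ t, deriv g t = -ρ ^ 2 * (t ^ 2)⁻¹ := fun t => by simp [g]
  have g2 : deriv (deriv g) (ψ x) = 2 * ρ ^ 2 * (ψ x ^ 3)⁻¹ := by
    have h := ((hasDerivAt_pow 2 (ψ x)).inv (pow_ne_zero 2 hne)).const_mul (-ρ ^ 2)
    have e' : deriv g = fun t => -ρ ^ 2 * (t ^ 2)⁻¹ := funext g1
    rw [e']
    refine h.deriv.trans ?_
    simp; field_simp
  have hn : ‖gradient ψ x‖ ^ 2 = 4 * ψ x := by
    simp only [ψ, norm_gradient_quad_sq, quad]; ring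
  have hgrad : gradient (g ∘ ψ) x = (deriv g (ψ x) * 2) • (x - z) := by
    refine ext_inner_right ℝ fun k => ?_
    rw [← fderiv_apply_eq_inner_gradient,
      fderiv_comp x (hg.differentiableAt (by norm_num)) (hψc.differentiableAt (by norm_num))]
    simp [ψ, fderiv_quad_apply, fderiv_eq_smul_deriv, PiLp.inner_apply, Fin.sum_univ_two]
    ring
  rw [e, hsm.laplacian_add contDiffAt_const, laplacian_smul_sub_const hgψ,
    laplacian_comp_real hg hψc, hgrad, g2, hn, laplacian_quad, smul_smul, ← add_smul, g1]
  have : 2 * (-ρ ^ 2 * (ψ x ^ 2)⁻¹ * 2) + (2 * ρ ^ 2 * (ψ x ^ 3)⁻¹ * (4 * ψ x) +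
      -ρ ^ 2 * (ψ x ^ 2)⁻¹ * (2 * 1 + 2 * 1)) = 0 := by
    field_simp; ring
  rw [this]
  simp

/-! ### Maximum principles -/

/-- Weak maximum principle relative to a positive comparison function `φ`: the quotient `w / φ`
has no negative interior minimum where `φ Δw < w Δφ`. -/
theorem nonneg_of_comparison {K : Set Plane} {w φ : Plane → ℝ} (hK : IsCompact K)
    (hw : ContinuousOn w K) (hφ : ContinuousOn φ K) (hpos : ∀ x ∈ K, 0 < φ x)
    (h : ∀ p ∈ K, w p < 0 → K ∈ 𝓝 p ∧ ContDiffAt ℝ 2 w p ∧ ContDiffAt ℝ 2 φ p ∧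
      φ p * Δ w p < w p * Δ φ p) :
    ∀ x ∈ K, 0 ≤ w x := by
  by_contra! hx
  obtain ⟨x, hxK, hx⟩ := hx
  obtain ⟨p, hpK, hp⟩ := hK.exists_isMinOn ⟨x, hxK⟩
    (hw.div hφ fun y hy => (hpos y hy).ne')
  have hpx : w p / φ p ≤ w x / φ x := hp hxK
  have hneg : w p / φ p < 0 := hpx.trans_lt (div_neg_of_neg_of_pos hx (hpos x hxK))
  have hwp : w p < 0 := by
    by_contra! hc
    exact absurd (div_nonneg hc (hpos p hpK).le) (not_le.2 hneg)
  obtain ⟨hKp, hw2, hφ2, hlt⟩ := h p hpK hwp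
  set m := -(w p / φ p) with hm
  have hmin : IsLocalMin (w + m • φ) p := by
    filter_upwards [hKp] with y hy
    have h1 : w p / φ p ≤ w y / φ y := hp hy
    have h2 : w p + m * φ p = 0 := by
      rw [hm]; field_simp [(hpos p hpK).ne']; ring
    have h3 : (w p / φ p) * φ y ≤ w y := (le_div_iff₀ (hpos y hy)).1 h1
    simp only [Pi.add_apply, Pi.smul_apply, smul_eq_mul]
    rw [h2, hm]; linarith
  have hmφ : ContDiffAt ℝ 2 (m • φ) p := contDiffAt_const.smul hφ2
  have h0 : 0 ≤ Δ (w + m • φ) p := laplacian_nonneg_of_isLocalMin (hw2.add hmφ) hmin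
  rw [hw2.laplacian_add hmφ, InnerProductSpace.laplacian_smul m hφ2, smul_eq_mul] at h0
  have h4 := mul_nonneg (hpos p hpK).le h0
  have h5 : φ p * (Δ w p + m * Δ φ p) = φ p * Δ w p - w p * Δ φ p := by
    rw [hm]; field_simp [(hpos p hpK).ne']; ring
  linarith

/-- The boundary point lemma of Hopf, on a disc: a positive solution of `Δw ≤ M w` cannot vanish
to second order at a boundary point of the disc. -/
theorem not_hasFDerivAt_zero_of_pos_on_ball {w : Plane → ℝ} {q p : Plane} {ρ M : ℝ}
    (hρ : 0 < ρ) (hM : 0 ≤ M) (hc : ContinuousOn w (Metric.closedBall q ρ))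
    (h2 : ∀ x ∈ Metric.ball q ρ, ContDiffAt ℝ 2 w x)
    (hΔ : ∀ x ∈ Metric.ball q ρ, Δ w x ≤ M * w x)
    (hpos : ∀ x ∈ Metric.ball q ρ, 0 < w x) (hp : dist p q = ρ) (hwp : w p = 0) :
    ¬ HasFDerivAt w (0 : Plane →L[ℝ] ℝ) p := by
  intro hder
  -- `α² ρ² > 4 α + M` makes the barrier a strict subsolution where `ρ / 2 < ‖x - q‖ < ρ`
  obtain ⟨α, hα1, hα⟩ : ∃ α : ℝ, 1 ≤ α ∧ 5 + M ≤ α * ρ ^ 2 := by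
    have h0 := div_nonneg (by linarith : 0 ≤ 5 + M) (sq_nonneg ρ)
    refine ⟨(5 + M) / ρ ^ 2 + 1, by linarith, ?_⟩
    have : (5 + M) / ρ ^ 2 * ρ ^ 2 = 5 + M := by field_simp
    nlinarith [sq_nonneg ρ]
  let ψ := quad (-α) (-α) (2 * α * q 0) (2 * α * q 1) (-α * (q 0 ^ 2 + q 1 ^ 2))
  have hψ : ∀ x, ψ x = -α * dist x q ^ 2 := fun x => by
    rw [dist_eq_norm, norm_sub_sq_eq_quad]; simp only [ψ, quad]; ring
  let κ := Real.exp (-α * ρ ^ 2)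
  have hκ : 0 < κ := Real.exp_pos _
  let h : Plane → ℝ := fun x => Real.exp (ψ x) - κ
  have hψc : ContDiff ℝ 2 ψ := contDiff_quad ..
  have hh : ContDiff ℝ 2 h := (Real.contDiff_exp.comp hψc).sub contDiff_const
  have hΔh : ∀ x, Δ h x = Real.exp (ψ x) * (4 * α ^ 2 * dist x q ^ 2 - 4 * α) := by
    intro x
    have e : h = (fun y => Real.exp (ψ y)) - fun _ => κ := rfl
    have he : ContDiffAt ℝ 2 (fun y => Real.exp (ψ y)) x :=
      (Real.contDiff_exp.comp hψc).contDiffAt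
    rw [e, he.laplacian_sub contDiffAt_const,
      laplacian_exp_comp hψc.contDiffAt, dist_eq_norm, norm_sub_sq_eq_quad]
    simp only [ψ, norm_gradient_quad_sq, laplacian_quad,
      InnerProductSpace.laplacian_const, quad, Pi.zero_apply]
    ring
  have hnn : ∀ x ∈ Metric.closedBall q ρ, 0 ≤ w x := by
    rw [← closure_ball q hρ.ne'] at hc ⊢
    exact fun x hx => le_on_closure (fun y hy => (hpos y hy).le) continuousOn_const hc hx
  have hsub : Metric.closedBall q (ρ / 2) ⊆ Metric.ball q ρ :=
    Metric.closedBall_subset_ball (by linarith)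
  obtain ⟨y, hy, hymin⟩ := (isCompact_closedBall q (ρ / 2)).exists_isMinOn
    ⟨q, Metric.mem_closedBall_self (by linarith)⟩
    (hc.mono (hsub.trans Metric.ball_subset_closedBall))
  set ε := w y with hε
  have hε0 : 0 < ε := hpos y (hsub hy)
  let K : Set Plane := {x | ρ / 2 ≤ dist x q ∧ dist x q ≤ ρ}
  have hdc : Continuous fun x => dist x q := by fun_prop
  have hKcl : IsClosed K := (isClosed_le continuous_const hdc).inter
    (isClosed_le hdc continuous_const)
  have hK : IsCompact K :=
    (isCompact_closedBall q ρ).of_isClosed_subset hKcl fun x hx => hx.2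
  have hεh : ContDiff ℝ 2 (ε • h) := contDiff_const.smul hh
  have hcomp : ∀ x ∈ K, 0 ≤ (w - ε • h) x := by
    refine nonneg_of_comparison (φ := fun _ => 1) hK
      ((hc.mono fun x hx => hx.2).sub hεh.continuous.continuousOn) continuousOn_const
      (fun _ _ => one_pos) fun x hx hneg => ?_
    simp only [Pi.sub_apply, Pi.smul_apply, smul_eq_mul] at hneg
    have hx1 : ρ / 2 < dist x q := by
      refine lt_of_le_of_ne hx.1 fun he => ?_
      have h1 : ε ≤ w x := hymin (show dist x q ≤ ρ / 2 from he.ge)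
      have h2 : h x ≤ 1 := by
        have : Real.exp (ψ x) ≤ 1 := by
          rw [Real.exp_le_one_iff, hψ]; nlinarith [sq_nonneg (dist x q)]
        simp only [h]; linarith
      nlinarith
    have hx2 : dist x q < ρ := by
      refine lt_of_le_of_ne hx.2 fun he => ?_
      have : h x = 0 := by simp [h, hψ, he, κ]
      have h1 := hnn x hx.2
      rw [this, mul_zero, sub_zero] at hneg
      exact absurd hneg (not_lt.2 h1)
    have hxb : x ∈ Metric.ball q ρ := hx2
    have hnh : K ∈ 𝓝 x := by
      have : IsOpen {x | ρ / 2 < dist x q ∧ dist x q < ρ} :=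
        (isOpen_lt continuous_const hdc).inter (isOpen_lt hdc continuous_const)
      exact mem_of_superset (this.mem_nhds ⟨hx1, hx2⟩) fun y hy => ⟨hy.1.le, hy.2.le⟩
    refine ⟨hnh, (h2 x hxb).sub hεh.contDiffAt, contDiffAt_const, ?_⟩
    rw [(h2 x hxb).laplacian_sub hεh.contDiffAt,
      InnerProductSpace.laplacian_smul ε hh.contDiffAt, hΔh]
    simp only [InnerProductSpace.laplacian_const, Pi.zero_apply, mul_zero, one_mul, smul_eq_mul]
    have h3 := hΔ x hxb
    have h4 : h x ≤ Real.exp (ψ x) := by simp only [h]; linarith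
    have h5 : M + 1 ≤ 4 * α ^ 2 * dist x q ^ 2 - 4 * α := by
      have : ρ ^ 2 ≤ 4 * dist x q ^ 2 := by nlinarith
      nlinarith [sq_nonneg α, mul_le_mul_of_nonneg_left hα (by linarith : 0 ≤ α),
        mul_le_mul_of_nonneg_left this (sq_nonneg α)]
    have h6 := Real.exp_pos (ψ x)
    have h7 : M * w x ≤ M * (ε * h x) := mul_le_mul_of_nonneg_left (by linarith) hM
    have h8 : M * (ε * h x) ≤ M * (ε * Real.exp (ψ x)) := by gcongr
    have h9 : ε * (Real.exp (ψ x) * (M + 1)) ≤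
      ε * (Real.exp (ψ x) * (4 * α ^ 2 * dist x q ^ 2 - 4 * α)) := by gcongr
    nlinarith [mul_pos hε0 h6]
  -- along the inner normal the barrier grows at least linearly
  have hlin : ∀ t ∈ Ioo (0 : ℝ) (1 / 2), ε * κ * (α * ρ ^ 2) * t ≤ w (p + t • (q - p)) := by
    intro t ht
    have hd : dist (p + t • (q - p)) q = (1 - t) * ρ := by
      have : p + t • (q - p) - q = (1 - t) • (p - q) := by module
      rw [dist_eq_norm, this, norm_smul, ← hp, dist_eq_norm p, Real.norm_eq_abs,
        abs_of_pos (by linarith [ht.2])]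
    have hm : p + t • (q - p) ∈ K := by
      constructor <;> rw [hd] <;> nlinarith [ht.1, ht.2]
    have h1 := hcomp _ hm
    simp only [Pi.sub_apply, Pi.smul_apply, smul_eq_mul, h, hψ, hd] at h1
    have h3 : -α * ((1 - t) * ρ) ^ 2 = -α * ρ ^ 2 + α * ρ ^ 2 * (2 * t - t ^ 2) := by ring
    rw [h3, Real.exp_add] at h1
    have h4 := Real.add_one_le_exp (α * ρ ^ 2 * (2 * t - t ^ 2))
    have h5 : α * ρ ^ 2 * t ≤ α * ρ ^ 2 * (2 * t - t ^ 2) :=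
      mul_le_mul_of_nonneg_left (by nlinarith [ht.1, ht.2]) (by linarith)
    have h6 : ε * (κ * (α * ρ ^ 2 * t)) ≤
        ε * (κ * (Real.exp (α * ρ ^ 2 * (2 * t - t ^ 2)) - 1)) := by
      gcongr; linarith
    have h7 : Real.exp (-α * ρ ^ 2) = κ := rfl
    rw [h7] at h1
    linarith
  have hγ : HasDerivAt (fun t : ℝ => w (p + t • (q - p))) 0 0 := by
    have h1 : HasDerivAt (fun t : ℝ => p + t • (q - p)) (q - p) 0 := by
      have := ((hasDerivAt_id (0 : ℝ)).smul_const (q - p)).const_add p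
      rwa [one_smul] at this
    have h3 : HasFDerivAt w (0 : Plane →L[ℝ] ℝ) (p + (0 : ℝ) • (q - p)) := by simpa using hder
    exact h3.comp_hasDerivAt 0 h1
  have hslope := (hasDerivAt_iff_tendsto_slope_zero.1 hγ).mono_left
    (nhdsGT_le_nhdsNE (0 : ℝ))
  have hpos' : 0 < ε * κ * (α * ρ ^ 2) := by positivity
  have hle : ε * κ * (α * ρ ^ 2) ≤ 0 := by
    refine ge_of_tendsto hslope ?_
    filter_upwards [Ioo_mem_nhdsGT (by norm_num : (0 : ℝ) < 1 / 2)] with t ht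
    have := hlin t ht
    simp only [zero_add, zero_smul, add_zero, hwp, sub_zero, smul_eq_mul]
    rw [inv_mul_eq_div, le_div_iff₀ ht.1]
    exact this
  linarith

/-- The strong maximum principle. -/
theorem eq_zero_or_pos_of_laplacian_le {G : Set Plane} {w : Plane → ℝ} {M : ℝ} (hG : IsOpen G)
    (hGc : IsPreconnected G) (hM : 0 ≤ M) (h2 : ∀ x ∈ G, ContDiffAt ℝ 2 w x)
    (hΔ : ∀ x ∈ G, Δ w x ≤ M * w x) (hnn : ∀ x ∈ G, 0 ≤ w x) :
    (∀ x ∈ G, w x = 0) ∨ ∀ x ∈ G, 0 < w x := by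
  have hc : ContinuousOn w G := fun x hx => (h2 x hx).continuousAt.continuousWithinAt
  have hopen : ∀ p ∈ G, w p = 0 → ∀ᶠ x in 𝓝 p, w x = 0 := by
    intro p hpG hwp
    obtain ⟨ε, hε, hball⟩ := Metric.isOpen_iff.1 hG p hpG
    filter_upwards [Metric.ball_mem_nhds p (half_pos hε)] with q hq
    by_contra hne
    have hqG : q ∈ G := hball (Metric.ball_subset_ball (by linarith) hq)
    have hqp : dist p q < ε / 2 := by rw [dist_comm]; exact hq
    have hsub : Metric.closedBall q (dist p q) ⊆ G := fun x hx => hball <| by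
      have h1 : dist x q ≤ dist p q := hx
      have h3 : dist q p < ε / 2 := hq
      have := dist_triangle x q p
      exact Metric.mem_ball.2 (by linarith)
    -- `p'` is a zero of `w` nearest to `q`
    have hZ : IsCompact (Metric.closedBall q (dist p q) ∩ w ⁻¹' {0}) :=
      (isCompact_closedBall q _).of_isClosed_subset
        ((hc.mono hsub).preimage_isClosed_of_isClosed Metric.isClosed_closedBall
          isClosed_singleton) inter_subset_left
    obtain ⟨p', ⟨hp'b, hp'0⟩, hp'⟩ := hZ.exists_isMinOn
      ⟨p, Metric.mem_closedBall.2 le_rfl, hwp⟩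
      (continuous_id.dist continuous_const : Continuous fun x => dist x q).continuousOn
    have hp'0 : w p' = 0 := hp'0
    have hp'd : dist p' q ≤ dist p q := hp'b
    have hρ : 0 < dist p' q := by
      rw [dist_pos]; rintro rfl; exact hne hp'0
    have hsub' : Metric.closedBall q (dist p' q) ⊆ G :=
      (Metric.closedBall_subset_closedBall hp'd).trans hsub
    have hsub'' : Metric.ball q (dist p' q) ⊆ G := Metric.ball_subset_closedBall.trans hsub'
    refine not_hasFDerivAt_zero_of_pos_on_ball hρ hM (hc.mono hsub')
      (fun x hx => h2 x (hsub'' hx)) (fun x hx => hΔ x (hsub'' hx)) (fun x hx => ?_) rfl hp'0 ?_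
    · refine lt_of_le_of_ne (hnn x (hsub'' hx)) fun he => ?_
      have hx' : dist x q < dist p' q := hx
      have : dist p' q ≤ dist x q :=
        hp' ⟨Metric.mem_closedBall.2 (hx'.le.trans hp'd), he.symm⟩
      linarith
    · have hp'G : p' ∈ G := hsub hp'b
      have hmin : IsLocalMin w p' := by
        filter_upwards [hG.mem_nhds hp'G] with x hx
        rw [hp'0]; exact hnn x hx
      rw [← hmin.fderiv_eq_zero]
      exact ((h2 p' hp'G).differentiableAt (by norm_num)).hasFDerivAt
  have hU : IsOpen {x | x ∈ G ∧ w x = 0} := isOpen_iff_mem_nhds.2 fun x hx =>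
    inter_mem (hG.mem_nhds hx.1) (hopen x hx.1 hx.2)
  have hV : IsOpen {x | x ∈ G ∧ 0 < w x} := hc.isOpen_inter_preimage hG isOpen_Ioi
  rcases hGc.subset_or_subset hU hV
    (disjoint_left.2 fun x h1 h3 => h3.2.ne' h1.2)
    (fun x hx => (hnn x hx).eq_or_lt.elim (fun h => Or.inl ⟨hx, h.symm⟩) fun h => Or.inr ⟨hx, h⟩)
    with h | h
  · exact Or.inl fun x hx => (h hx).2
  · exact Or.inr fun x hx => (h hx).2

/-! ### The method of moving planes for a family of conformal reflections -/

/-- The geometric data of a moving-plane argument in `Ω`. The level sets `{τ = t}`, `s < t ≤ e`,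
are the moving mirrors, `T t` is the reflection in `{τ = t}` (in a line or in a circle), and
`Ω ∩ {τ < t}` is the cap to be reflected; it is empty for `t = s`. The function `η` is nonnegative
and vanishes on the part of the boundary of `Ω` that the caps meet. -/
structure IsMovingFamily (Ω : Set Plane) (τ η : Plane → ℝ) (T : ℝ → Plane → Plane)
    (s e : ℝ) : Prop where
  contDiff_level : ContDiff ℝ 2 τ
  contDiff_depth : ContDiff ℝ 2 η
  le_level : ∀ x ∈ closure Ω, s ≤ τ x
  continuousAt : ∀ t, ∀ x ∈ closure Ω, ContinuousAt (fun q : ℝ × Plane => T q.1 q.2) (t, x)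
  contDiffAt : ∀ t ∈ Icc s e, ∀ x ∈ Ω, ContDiffAt ℝ 2 (T t) x
  mapsTo : ∀ t ∈ Icc s e, ∀ x ∈ Ω, τ x < t → T t x ∈ Ω
  fixed : ∀ t, ∀ x ∈ closure Ω, τ x = t → T t x = x
  conformal : ∀ t ∈ Icc s e, ∀ x ∈ Ω, τ x < t → ∃ c : ℝ, 1 ≤ c ∧ ∃ A : Plane ≃ₗᵢ[ℝ] Plane,
    (∀ h, fderiv ℝ (T t) x h = c • A h) ∧ Δ (T t) x = 0
  gradient_bound : ∃ m > 0, ∀ x ∈ Ω, τ x < e →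
    m ≤ ‖gradient τ x‖ ^ 2 ∧ m ≤ ‖gradient η x‖ ^ 2
  laplacian_bound : ∃ L : ℝ, 0 ≤ L ∧ ∀ x, -L ≤ Δ τ x ∧ Δ η x ≤ L
  depth_nonneg : ∀ x ∈ closure Ω, 0 ≤ η x
  depth_frontier : ∀ x ∈ frontier Ω, τ x < e → η x ≤ 0
  isPreconnected : ∀ t ∈ Icc s e, IsPreconnected {x | x ∈ Ω ∧ τ x < t}
  interior_ball : ∀ x ∈ Ω, ∀ ε > 0, ∃ q ρ, 0 < ρ ∧ ρ < ε ∧ dist x q = ρ ∧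
    ∀ y ∈ Metric.ball q ρ, τ y < τ x
  exists_moved : ∀ t ∈ Ioc s e, ∃ y ∈ frontier Ω, τ y < t ∧ T t y ∈ Ω

/-- For large `k` the function `4 - exp (k (τ - t)) - exp (-k η)` is positive in the cap and a
strict supersolution of `Δφ + M φ = 0` near the boundary of the cap. The constant `k` does not
depend on the mirror. -/
theorem exists_comparison {Ω : Set Plane} {τ η : Plane → ℝ} {T : ℝ → Plane → Plane} {s e : ℝ}
    (H : IsMovingFamily Ω τ η T s e) {M : ℝ} (hM : 0 ≤ M) :
    ∃ k > 0, ∀ t ≤ e, ∃ φ : Plane → ℝ, ContDiff ℝ 2 φ ∧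
      (∀ x ∈ closure Ω, τ x ≤ t → 0 < φ x) ∧
      ∀ x ∈ Ω, τ x < t → (t - 1 / k < τ x ∨ η x < 1 / k) → Δ φ x < -(M * φ x) := by
  obtain ⟨m, hm, hmb⟩ := H.gradient_bound
  obtain ⟨L, hL, hLb⟩ := H.laplacian_bound
  have hE : 0 < Real.exp 1 := Real.exp_pos 1
  -- `k m - L ≥ 1` makes both exponential terms superharmonic; where one of the two exponents is at
  -- least `-1`, `k / exp 1 > 4 M` makes `Δφ` less than `-4 M ≤ -M φ`
  obtain ⟨k, hk0, hk1, hk2⟩ : ∃ k : ℝ, 0 < k ∧ 1 ≤ k * m - L ∧ 4 * M * Real.exp 1 < k := by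
    have h1 : 0 ≤ (1 + L) / m := by positivity
    have h2 : 0 ≤ 4 * M * Real.exp 1 := by positivity
    refine ⟨(1 + L) / m + 4 * M * Real.exp 1 + 1, by linarith, ?_, by linarith⟩
    have : (1 + L) / m * m = 1 + L := by field_simp
    nlinarith [mul_nonneg h2 hm.le]
  refine ⟨k, hk0, fun t hte => ?_⟩
  let ψ₁ : Plane → ℝ := fun x => k * (τ x - t)
  let ψ₂ : Plane → ℝ := fun x => -k * η x
  have h1c : ContDiff ℝ 2 ψ₁ := contDiff_const.mul (H.contDiff_level.sub contDiff_const)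
  have h2c : ContDiff ℝ 2 ψ₂ := contDiff_const.mul H.contDiff_depth
  have hτd : ∀ x, DifferentiableAt ℝ τ x := fun x =>
    H.contDiff_level.contDiffAt.differentiableAt (by norm_num)
  have hηd : ∀ x, DifferentiableAt ℝ η x := fun x =>
    H.contDiff_depth.contDiffAt.differentiableAt (by norm_num)
  have hg1 : ∀ x, gradient ψ₁ x = k • gradient τ x := fun x => ext_inner_right ℝ fun y => by
    rw [← fderiv_apply_eq_inner_gradient, inner_smul_left, ← fderiv_apply_eq_inner_gradient,
      fderiv_const_mul ((hτd x).sub_const t), fderiv_sub_const]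
    simp
  have hg2 : ∀ x, gradient ψ₂ x = (-k) • gradient η x := fun x => ext_inner_right ℝ fun y => by
    rw [← fderiv_apply_eq_inner_gradient, inner_smul_left, ← fderiv_apply_eq_inner_gradient,
      fderiv_const_mul (hηd x)]
    simp
  have hl1 : ∀ x, Δ ψ₁ x = k * Δ τ x := fun x => by
    have e1 : ψ₁ = k • (τ - fun _ => t) := rfl
    have hτt : ContDiffAt ℝ 2 (τ - fun _ => t) x :=
      H.contDiff_level.contDiffAt.sub contDiffAt_const
    rw [e1, InnerProductSpace.laplacian_smul k hτt,
      H.contDiff_level.contDiffAt.laplacian_sub contDiffAt_const]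
    simp
  have hl2 : ∀ x, Δ ψ₂ x = -k * Δ η x := fun x => by
    have e1 : ψ₂ = (-k) • η := rfl
    rw [e1, InnerProductSpace.laplacian_smul (-k) H.contDiff_depth.contDiffAt, smul_eq_mul]
  have hE1 : ContDiff ℝ 2 (fun x => Real.exp (ψ₁ x)) := Real.contDiff_exp.comp h1c
  have hE2 : ContDiff ℝ 2 (fun x => Real.exp (ψ₂ x)) := Real.contDiff_exp.comp h2c
  refine ⟨(fun _ => 4) - (fun x => Real.exp (ψ₁ x)) - fun x => Real.exp (ψ₂ x),
    (contDiff_const.sub hE1).sub hE2, fun x hx hxt => ?_, fun x hx hxt hor => ?_⟩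
  · have h1 : Real.exp (ψ₁ x) ≤ 1 := Real.exp_le_one_iff.2
      (mul_nonpos_of_nonneg_of_nonpos hk0.le (by linarith))
    have h2 : Real.exp (ψ₂ x) ≤ 1 := Real.exp_le_one_iff.2
      (mul_nonpos_of_nonpos_of_nonneg (by linarith) (H.depth_nonneg x hx))
    simp only [Pi.sub_apply]
    linarith
  · have hx1 := Real.exp_pos (ψ₁ x)
    have hx2 := Real.exp_pos (ψ₂ x)
    have h41 : ContDiff ℝ 2 ((fun _ => 4) - fun x => Real.exp (ψ₁ x)) := contDiff_const.sub hE1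
    rw [h41.contDiffAt.laplacian_sub hE2.contDiffAt,
      contDiff_const.contDiffAt.laplacian_sub hE1.contDiffAt, laplacian_exp_comp h1c.contDiffAt,
      laplacian_exp_comp h2c.contDiffAt, hl1, hl2, hg1, hg2, norm_smul, norm_smul]
    simp only [InnerProductSpace.laplacian_const, Pi.zero_apply, Pi.sub_apply, mul_pow,
      Real.norm_eq_abs, sq_abs, neg_sq]
    obtain ⟨hm1, hm2⟩ := hmb x hx (hxt.trans_le hte)
    obtain ⟨hL1, hL2⟩ := hLb x
    have hB1 : k ≤ k ^ 2 * ‖gradient τ x‖ ^ 2 + k * Δ τ x := by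
      nlinarith [mul_le_mul_of_nonneg_left hm1 (sq_nonneg k)]
    have hB2 : k ≤ k ^ 2 * ‖gradient η x‖ ^ 2 + -k * Δ η x := by
      nlinarith [mul_le_mul_of_nonneg_left hm2 (sq_nonneg k)]
    have hC1 := mul_le_mul_of_nonneg_left hB1 hx1.le
    have hC2 := mul_le_mul_of_nonneg_left hB2 hx2.le
    have hkE : 4 * M < k * Real.exp (-1) := by
      rw [Real.exp_neg, ← div_eq_mul_inv, lt_div_iff₀ hE]; exact hk2
    have hsum : Real.exp (-1) ≤ Real.exp (ψ₁ x) + Real.exp (ψ₂ x) := by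
      rcases hor with h | h
      · have : Real.exp (-1) ≤ Real.exp (ψ₁ x) := Real.exp_le_exp.2 <| by
          have : k * (1 / k) = 1 := by field_simp
          simp only [ψ₁]; nlinarith
        linarith
      · have : Real.exp (-1) ≤ Real.exp (ψ₂ x) := Real.exp_le_exp.2 <| by
          have : k * (1 / k) = 1 := by field_simp
          simp only [ψ₂]; nlinarith
        linarith
    have := mul_le_mul_of_nonneg_left hsum hk0.le
    have := mul_nonneg hM hx1.le
    have := mul_nonneg hM hx2.le
    nlinarith

section Moving

variable {Ω : Set Plane} {τ η : Plane → ℝ} {T : ℝ → Plane → Plane} {s e : ℝ}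
  {f : ℝ → ℝ} {u : Plane → ℝ}

theorem IsMovingFamily.mem_closure (H : IsMovingFamily Ω τ η T s e) {t : ℝ} (ht : t ∈ Icc s e)
    {x : Plane} (hx : x ∈ closure Ω) (hxt : τ x ≤ t) : T t x ∈ closure Ω := by
  rcases hxt.eq_or_lt with h | h
  · rwa [H.fixed t x hx h]
  · have hc : ContinuousAt (T t) x :=
      ContinuousAt.comp (f := fun y => (t, y)) (g := fun q : ℝ × Plane => T q.1 q.2)
        (H.continuousAt t x hx) (by fun_prop)
    have hcap : x ∈ closure ({y | τ y < t} ∩ Ω) :=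
      (isOpen_lt H.contDiff_level.continuous continuous_const).inter_closure ⟨h, hx⟩
    exact hc.continuousWithinAt.mem_closure hcap fun y hy => H.mapsTo t ht y hy.2 hy.1

theorem exists_lipschitz_bound (hf : LocallyLipschitz f) (hu : IsDirichletSolution f Ω u)
    (hb : Bornology.IsBounded Ω) :
    ∃ M : ℝ, 0 ≤ M ∧ ∀ x ∈ closure Ω, ∀ y ∈ closure Ω, |f (u x) - f (u y)| ≤ M * |u x - u y| := by
  have hK : IsCompact (u '' closure Ω) := hb.isCompact_closure.image_of_continuousOn hu.continuousOn
  obtain ⟨M, hM⟩ := hf.locallyLipschitzOn.exists_lipschitzOnWith_of_compact hK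
  refine ⟨M, M.2, fun x hx y hy => ?_⟩
  simpa [Real.dist_eq] using hM.dist_le_mul _ (mem_image_of_mem u hx) _ (mem_image_of_mem u hy)

/-- The difference between a solution and its reflection is a supersolution of a linear equation
in the cap. The dilation factor of the reflection is at least `1`, so that `f(u) ≥ 0` absorbs it. -/
theorem IsMovingFamily.laplacian_sub_le (H : IsMovingFamily Ω τ η T s e) (hΩ : IsOpen Ω)
    (hu : IsDirichletSolution f Ω u) (hf0 : ∀ x ∈ Ω, 0 ≤ f (u x)) {M : ℝ}
    (hM : ∀ x ∈ closure Ω, ∀ y ∈ closure Ω, |f (u x) - f (u y)| ≤ M * |u x - u y|)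
    {t : ℝ} (ht : t ∈ Icc s e) {x : Plane} (hx : x ∈ Ω) (hxt : τ x < t) :
    ContDiffAt ℝ 2 (u ∘ T t - u) x ∧ Δ (u ∘ T t - u) x ≤ M * |(u ∘ T t - u) x| := by
  have hTx := H.mapsTo t ht x hx hxt
  have h2 : ∀ y ∈ Ω, ContDiffAt ℝ 2 u y := fun y hy => hu.contDiffOn.contDiffAt (hΩ.mem_nhds hy)
  have hT2 := H.contDiffAt t ht x hx
  have hc2 : ContDiffAt ℝ 2 (u ∘ T t) x := (h2 _ hTx).comp x hT2
  obtain ⟨c, hc, A, hA, hΔ⟩ := H.conformal t ht x hx hxt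
  refine ⟨hc2.sub (h2 x hx), ?_⟩
  rw [hc2.laplacian_sub (h2 x hx), laplacian_comp_conformal (h2 _ hTx) hT2 hA hΔ]
  have e1 := hu.equation x hx
  have e2 := hu.equation _ hTx
  have h3 := hf0 _ hTx
  have h4 := le_of_abs_le (hM x (subset_closure hx) _ (subset_closure hTx))
  rw [abs_sub_comm] at h4
  have h5 : f (u (T t x)) ≤ c ^ 2 * f (u (T t x)) := le_mul_of_one_le_left h3 (by nlinarith)
  have h6 : Δ u (T t x) = -f (u (T t x)) := by linarith
  rw [h6]
  simp only [Pi.sub_apply, Function.comp_apply]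
  linarith

/-- The strong maximum principle in a cap: the difference does not vanish identically, since it is
positive at the boundary point that `exists_moved` provides. -/
theorem IsMovingFamily.pos_of_nonneg (H : IsMovingFamily Ω τ η T s e) (hΩ : IsOpen Ω)
    (hf : LocallyLipschitz f) (hb : Bornology.IsBounded Ω)
    (hu : IsDirichletSolution f Ω u) (hf0 : ∀ x ∈ Ω, 0 ≤ f (u x)) (hu0 : ∀ x ∈ Ω, 0 < u x)
    {t : ℝ} (ht : t ∈ Icc s e) (hnn : ∀ x ∈ Ω, τ x < t → 0 ≤ (u ∘ T t - u) x) :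
    ∀ x ∈ Ω, τ x < t → 0 < (u ∘ T t - u) x := by
  rcases ht.1.eq_or_lt with rfl | hst
  · exact fun x hx hxt => absurd (H.le_level x (subset_closure hx)) (not_le.2 hxt)
  obtain ⟨M, hM0, hM⟩ := exists_lipschitz_bound hf hu hb
  have hopen : IsOpen {y | τ y < t} := isOpen_lt H.contDiff_level.continuous continuous_const
  rcases eq_zero_or_pos_of_laplacian_le (w := u ∘ T t - u) (hΩ.inter hopen)
    (H.isPreconnected t ht) hM0
    (fun x hx => (H.laplacian_sub_le hΩ hu hf0 hM ht hx.1 hx.2).1)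
    (fun x hx => by
      have := (H.laplacian_sub_le hΩ hu hf0 hM ht hx.1 hx.2).2
      rwa [abs_of_nonneg (hnn x hx.1 hx.2)] at this)
    (fun x hx => hnn x hx.1 hx.2) with h | h
  · exfalso
    obtain ⟨y, hy, hyt, hTy⟩ := H.exists_moved t ⟨hst, ht.2⟩
    have hycl : y ∈ closure Ω := frontier_subset_closure hy
    have hcap : y ∈ closure ({y | τ y < t} ∩ Ω) := hopen.inter_closure ⟨hyt, hycl⟩
    have hTc : ContinuousAt (T t) y :=
      ContinuousAt.comp (f := fun y => (t, y)) (g := fun q : ℝ × Plane => T q.1 q.2)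
        (H.continuousAt t y hycl) (by fun_prop)
    have huc : ContinuousAt u (T t y) := hu.continuousOn.continuousAt
      (mem_of_superset (hΩ.mem_nhds hTy) subset_closure)
    have hwc : ContinuousWithinAt (u ∘ T t - u) ({y | τ y < t} ∩ Ω) y :=
      (ContinuousAt.comp huc hTc).continuousWithinAt.sub
        ((hu.continuousOn y hycl).mono (inter_subset_right.trans subset_closure))
    have h0 : (u ∘ T t - u) y ∈ closure ({0} : Set ℝ) :=
      hwc.mem_closure hcap fun x hx => h x ⟨hx.2, hx.1⟩
    simp only [closure_singleton, mem_singleton_iff, Pi.sub_apply, Function.comp_apply,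
      hu.boundary y hy] at h0
    have := hu0 _ hTy
    linarith
  · exact fun x hx hxt => h x ⟨hx, hxt⟩

/-- The maximum principle for the part of a cap near its boundary. -/
theorem IsMovingFamily.exists_nonneg_of_nonneg_inside (H : IsMovingFamily Ω τ η T s e)
    (hΩ : IsOpen Ω) (hf : LocallyLipschitz f) (hb : Bornology.IsBounded Ω)
    (hu : IsDirichletSolution f Ω u) (hf0 : ∀ x ∈ Ω, 0 ≤ f (u x))
    (hu0 : ∀ x ∈ closure Ω, 0 ≤ u x) :
    ∃ δ > 0, ∀ t ∈ Icc s e,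
      (∀ x ∈ Ω, τ x ≤ t - δ → δ ≤ η x → 0 ≤ (u ∘ T t - u) x) →
      ∀ x ∈ Ω, τ x < t → 0 ≤ (u ∘ T t - u) x := by
  obtain ⟨M, hM0, hM⟩ := exists_lipschitz_bound hf hu hb
  obtain ⟨k, hk, hφ⟩ := exists_comparison H hM0
  refine ⟨1 / k, by positivity, fun t ht hin x hx hxt => ?_⟩
  obtain ⟨φ, hφ2, hφ0, hφΔ⟩ := hφ t ht.2
  have hτc := H.contDiff_level.continuous
  have hK : IsCompact (closure Ω ∩ {y | τ y ≤ t}) :=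
    hb.isCompact_closure.inter_right (isClosed_le hτc continuous_const)
  have hw : ContinuousOn (u ∘ T t - u) (closure Ω ∩ {y | τ y ≤ t}) := by
    refine ContinuousOn.sub (hu.continuousOn.comp (fun y hy => ?_) fun y hy =>
      H.mem_closure ht hy.1 hy.2) (hu.continuousOn.mono inter_subset_left)
    exact (ContinuousAt.comp (f := fun y => (t, y)) (g := fun q : ℝ × Plane => T q.1 q.2)
        (H.continuousAt t y hy.1) (by fun_prop)).continuousWithinAt
  refine nonneg_of_comparison hK hw hφ2.continuous.continuousOn (fun y hy => hφ0 y hy.1 hy.2)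
    (fun p hp hneg => ?_) x ⟨subset_closure hx, hxt.le⟩
  have hpΩ : p ∈ Ω := by
    by_contra hn
    have hfr : p ∈ frontier Ω := by
      rw [hΩ.frontier_eq]; exact ⟨hp.1, hn⟩
    have := hu0 _ (H.mem_closure ht hp.1 hp.2)
    simp only [Pi.sub_apply, Function.comp_apply, hu.boundary p hfr] at hneg
    linarith
  have hpt : τ p < t := by
    refine lt_of_le_of_ne hp.2 fun he => ?_
    simp [H.fixed t p hp.1 he] at hneg
  obtain ⟨hw2, hwΔ⟩ := H.laplacian_sub_le hΩ hu hf0 hM ht hpΩ hpt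
  refine ⟨?_, hw2, hφ2.contDiffAt, ?_⟩
  · filter_upwards [hΩ.mem_nhds hpΩ,
      (isOpen_lt hτc continuous_const).mem_nhds (show p ∈ {y | τ y < t} from hpt)] with y h1 h2
    exact ⟨subset_closure h1, le_of_lt h2⟩
  · have hor : t - 1 / k < τ p ∨ η p < 1 / k := by
      by_contra! hc
      exact absurd (hin p hpΩ hc.1 hc.2) (not_le.2 hneg)
    have h1 := hφΔ p hpΩ hpt hor
    have h0 := hφ0 p hp.1 hp.2
    rw [abs_of_neg hneg] at hwΔ
    nlinarith [mul_le_mul_of_nonneg_left hwΔ h0.le, mul_lt_mul_of_neg_left h1 hneg]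

/-- In every cap the reflected solution lies above the solution. -/
theorem IsMovingFamily.nonneg (H : IsMovingFamily Ω τ η T s e) (hΩ : IsOpen Ω)
    (hf : LocallyLipschitz f) (hb : Bornology.IsBounded Ω)
    (hu : IsDirichletSolution f Ω u) (hf0 : ∀ x ∈ Ω, 0 ≤ f (u x)) (hu0 : ∀ x ∈ Ω, 0 < u x) :
    ∀ t ∈ Icc s e, ∀ x ∈ Ω, τ x < t → 0 ≤ (u ∘ T t - u) x := by
  have hu0' : ∀ x ∈ closure Ω, 0 ≤ u x := fun x hx =>
    le_on_closure (fun y hy => (hu0 y hy).le) continuousOn_const hu.continuousOn hx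
  obtain ⟨δ, hδ, hδt⟩ := H.exists_nonneg_of_nonneg_inside hΩ hf hb hu hf0 hu0'
  have hτc := H.contDiff_level.continuous
  have hwc : ∀ t ∈ Icc s e, ∀ x ∈ Ω, τ x < t →
      ContinuousAt (fun q : ℝ × Plane => (u ∘ T q.1 - u) q.2) (t, x) := by
    intro t ht x hx hxt
    have huc : ∀ y ∈ Ω, ContinuousAt u y := fun y hy => hu.continuousOn.continuousAt
      (mem_of_superset (hΩ.mem_nhds hy) subset_closure)
    exact (ContinuousAt.comp (f := fun q : ℝ × Plane => T q.1 q.2) (g := u)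
      (huc _ (H.mapsTo t ht x hx hxt)) (H.continuousAt t x (subset_closure hx))).sub
      (ContinuousAt.comp (f := fun q : ℝ × Plane => q.2) (huc x hx) (by fun_prop))
  refine fun t ht => IsClosed.Icc_subset_of_forall_mem_nhdsWithin
    (s := {t | ∀ x ∈ Ω, τ x < t → 0 ≤ (u ∘ T t - u) x}) ?_ ?_ ?_ ht
  · refine isClosed_of_closure_subset fun t ht => ?_
    have htI : t ∈ Icc s e := closure_minimal inter_subset_right isClosed_Icc ht
    refine ⟨fun x hx hxt => ?_, htI⟩
    by_contra! hneg
    have h1 : ContinuousAt (fun r => (u ∘ T r - u) x) t :=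
      ContinuousAt.comp (f := fun r => (r, x)) (hwc t htI x hx hxt) (by fun_prop)
    have h2 := (mem_closure_iff_frequently.1 ht).and_eventually
      ((h1.eventually_lt_const hneg).and (lt_mem_nhds hxt))
    obtain ⟨r, hr, hr1, hr2⟩ := h2.exists
    exact absurd (hr.1 x hx hr2) (not_le.2 hr1)
  · exact fun x hx hxs => absurd (H.le_level x (subset_closure hx)) (not_le.2 hxs)
  · rintro t ⟨htS, hts, hte⟩
    have hpos := H.pos_of_nonneg hΩ hf hb hu hf0 hu0 ⟨hts, hte.le⟩ htS
    -- the compact part of the nearby caps, on which positivity persists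
    let K := closure Ω ∩ {x | τ x ≤ t - δ / 2} ∩ {x | δ ≤ η x}
    have hK : IsCompact K :=
      (hb.isCompact_closure.inter_right (isClosed_le hτc continuous_const)).inter_right
        (isClosed_le continuous_const H.contDiff_depth.continuous)
    have hKΩ : ∀ x ∈ K, x ∈ Ω ∧ τ x < t := by
      rintro x ⟨⟨hx, hxt⟩, hxη⟩
      have hxt : τ x ≤ t - δ / 2 := hxt
      have hxη : δ ≤ η x := hxη
      refine ⟨?_, by linarith⟩
      by_contra hn
      have := H.depth_frontier x (by rw [hΩ.frontier_eq]; exact ⟨hx, hn⟩) (by linarith)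
      linarith
    have hev : ∀ᶠ r in 𝓝 t, ∀ x ∈ K, 0 < (u ∘ T r - u) x := by
      refine hK.eventually_forall_of_forall_eventually fun x hx => ?_
      obtain ⟨h1, h2⟩ := hKΩ x hx
      exact (hwc t ⟨hts, hte.le⟩ x h1 h2).eventually_const_lt (hpos x h1 h2)
    filter_upwards [nhdsWithin_le_nhds hev, Ioc_mem_nhdsGT hte,
      Ioc_mem_nhdsGT (show t < t + δ / 2 by linarith)] with r hr hr1 hr2
    refine hδt r ⟨hts.trans hr1.1.le, hr1.2⟩ fun x hx hxr hxη =>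
      (hr x ⟨⟨subset_closure hx, ?_⟩, hxη⟩).le
    have := hr2.2
    show τ x ≤ t - δ / 2
    linarith

/-- There are no critical points on the mirrors of a moving family. -/
theorem IsMovingFamily.gradient_ne_zero (H : IsMovingFamily Ω τ η T s e) (hΩ : IsOpen Ω)
    (hf : LocallyLipschitz f) (hb : Bornology.IsBounded Ω)
    (hu : IsDirichletSolution f Ω u) (hf0 : ∀ x ∈ Ω, 0 ≤ f (u x)) (hu0 : ∀ x ∈ Ω, 0 < u x)
    {x : Plane} (hx : x ∈ Ω) (hxe : τ x ≤ e) : gradient u x ≠ 0 := by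
  intro hgrad
  set t := τ x with htx
  have ht : t ∈ Icc s e := ⟨H.le_level x (subset_closure hx), hxe⟩
  have hpos := H.pos_of_nonneg hΩ hf hb hu hf0 hu0 ht (H.nonneg hΩ hf hb hu hf0 hu0 t ht)
  obtain ⟨M, hM0, hM⟩ := exists_lipschitz_bound hf hu hb
  have hTx : T t x = x := H.fixed t x (subset_closure hx) htx.symm
  have h2 : ∀ y ∈ Ω, ContDiffAt ℝ 2 u y := fun y hy => hu.contDiffOn.contDiffAt (hΩ.mem_nhds hy)
  have hTc : ContinuousAt (T t) x := (H.contDiffAt t ht x hx).continuousAt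
  have hTΩ : ∀ᶠ y in 𝓝 x, y ∈ Ω ∧ T t y ∈ Ω :=
    (show ∀ᶠ y in 𝓝 x, y ∈ Ω from hΩ.mem_nhds hx).and
      (hTc.eventually_mem (by rw [hTx]; exact hΩ.mem_nhds hx))
  obtain ⟨ε, hε, hεΩ⟩ := Metric.eventually_nhds_iff.1 hTΩ
  obtain ⟨q, ρ, hρ, hρε, hq, hball⟩ := H.interior_ball x hx (ε / 2) (half_pos hε)
  have hsub : ∀ y ∈ Metric.closedBall q ρ, y ∈ Ω ∧ T t y ∈ Ω := fun y hy => hεΩ <| by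
    have h1 : dist y q ≤ ρ := hy
    have h3 := dist_triangle y q x
    rw [dist_comm q x, hq] at h3
    linarith
  have hb' : ∀ y ∈ Metric.ball q ρ, y ∈ Ω ∧ τ y < t := fun y hy =>
    ⟨(hsub y (Metric.ball_subset_closedBall hy)).1, hball y hy⟩
  refine not_hasFDerivAt_zero_of_pos_on_ball (w := u ∘ T t - u) hρ hM0 ?_
    (fun y hy => (H.laplacian_sub_le hΩ hu hf0 hM ht (hb' y hy).1 (hb' y hy).2).1)
    (fun y hy => ?_) (fun y hy => hpos y (hb' y hy).1 (hb' y hy).2) hq (by simp [hTx]) ?_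
  · intro y hy
    obtain ⟨h1, h3⟩ := hsub y hy
    exact ((ContinuousAt.comp (h2 _ h3).continuousAt (H.contDiffAt t ht y h1).continuousAt).sub
      (h2 y h1).continuousAt).continuousWithinAt
  · have := (H.laplacian_sub_le hΩ hu hf0 hM ht (hb' y hy).1 (hb' y hy).2).2
    rwa [abs_of_pos (hpos y (hb' y hy).1 (hb' y hy).2)] at this
  · -- both `u` and its reflection have derivative zero at a critical point on the mirror
    have hu' : HasFDerivAt u (0 : Plane →L[ℝ] ℝ) x := by
      have h4 := ((h2 x hx).differentiableAt (by norm_num)).hasFDerivAt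
      rwa [← toDual_gradient, hgrad, map_zero] at h4
    have hT' := ((H.contDiffAt t ht x hx).differentiableAt (by norm_num)).hasFDerivAt
    have hu'' : HasFDerivAt u (0 : Plane →L[ℝ] ℝ) (T t x) := by rwa [hTx]
    simpa using (hu''.comp x hT').sub hu'

/-- A nonconstant solution with `f(u) ≥ 0` is positive. -/
theorem pos_of_isNonconstantOn (hΩ : IsOpen Ω) (hc : IsPreconnected Ω)
    (hb : Bornology.IsBounded Ω) (hu : IsDirichletSolution f Ω u) (hf0 : ∀ x ∈ Ω, 0 ≤ f (u x))
    (hn : IsNonconstantOn u Ω) : ∀ x ∈ Ω, 0 < u x := by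
  have h2 : ∀ y ∈ Ω, ContDiffAt ℝ 2 u y := fun y hy => hu.contDiffOn.contDiffAt (hΩ.mem_nhds hy)
  have hΔ : ∀ y ∈ Ω, Δ u y ≤ 0 := fun y hy => by
    have := hu.equation y hy; have := hf0 y hy; linarith
  obtain ⟨B, hB0, hB⟩ := hb.closure.exists_pos_norm_le
  -- a positive strictly superharmonic function
  let φ := quad (-1) (-1) 0 0 (B ^ 2 + 1)
  have hφ2 : ContDiff ℝ 2 φ := contDiff_quad ..
  have hnn : ∀ x ∈ closure Ω, 0 ≤ u x := by
    refine nonneg_of_comparison (φ := φ) hb.isCompact_closure hu.continuousOn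
      hφ2.continuous.continuousOn (fun x hx => ?_) fun p hp hneg => ?_
    · have h3 : ‖x‖ ^ 2 ≤ B ^ 2 := by gcongr; exact hB x hx
      rw [EuclideanSpace.norm_sq_eq, Fin.sum_univ_two] at h3
      simp only [Real.norm_eq_abs, sq_abs] at h3
      simp only [φ, quad]
      linarith
    · have hpΩ : p ∈ Ω := by
        by_contra hpn
        rw [hu.boundary p (by rw [hΩ.frontier_eq]; exact ⟨hp, hpn⟩)] at hneg
        exact lt_irrefl _ hneg
      refine ⟨mem_of_superset (hΩ.mem_nhds hpΩ) subset_closure, h2 p hpΩ, hφ2.contDiffAt, ?_⟩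
      have h3 : ‖p‖ ^ 2 ≤ B ^ 2 := by gcongr; exact hB p hp
      rw [EuclideanSpace.norm_sq_eq, Fin.sum_univ_two] at h3
      simp only [Real.norm_eq_abs, sq_abs] at h3
      have h4 : 0 < φ p := by simp only [φ, quad]; linarith
      have h5 : Δ φ p = -4 := by simp only [φ, laplacian_quad]; norm_num
      rw [h5]
      nlinarith [mul_nonneg h4.le (neg_nonneg.2 (hΔ p hpΩ))]
  rcases eq_zero_or_pos_of_laplacian_le (M := 0) hΩ hc le_rfl h2 (by simpa using hΔ)
    (fun x hx => hnn x (subset_closure hx)) with h | h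
  · obtain ⟨p, hp, q, hq, hpq⟩ := hn
    exact absurd ((h p hp).trans (h q hq).symm) hpq
  · exact h

end Moving

/-! ### Ellipses with a round hole -/

/-- A convex set with a round hole is connected. -/
theorem isPreconnected_diff_closedBall {D : Set Plane} {z : Plane} {r r' : ℝ} (hD : Convex ℝ D)
    (hr : 0 ≤ r) (hrr' : r < r') (hsub : Metric.closedBall z r' ⊆ D) :
    IsPreconnected (D \ Metric.closedBall z r) := by
  have hr' : 0 < r' := hr.trans_lt hrr'
  have hS : Metric.sphere z r' ⊆ D \ Metric.closedBall z r := fun x hx =>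
    ⟨hsub (Metric.sphere_subset_closedBall hx), fun h => by
      have h1 : dist x z = r' := hx
      have h2 : dist x z ≤ r := h
      linarith⟩
  have hSc : IsPreconnected (Metric.sphere z r') := by
    refine isPreconnected_sphere ?_ z r'
    rw [rank_eq_card_basis (EuclideanSpace.basisFun (Fin 2) ℝ).toBasis]
    simp
  obtain ⟨x₀, hx₀⟩ : (Metric.sphere z r').Nonempty := NormedSpace.sphere_nonempty.2 hr'.le
  -- the sphere of radius `r'` together with a radial segment joins any point to `x₀`
  refine isPreconnected_of_forall x₀ fun y hy => ?_
  have hyd : r < dist y z := by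
    by_contra! h; exact hy.2 h
  have hyd0 : 0 < dist y z := hr.trans_lt hyd
  set y' := z + (r' / dist y z) • (y - z) with hy'
  have hy'S : y' ∈ Metric.sphere z r' := by
    rw [mem_sphere_iff_norm, hy', add_sub_cancel_left, norm_smul, ← dist_eq_norm, Real.norm_eq_abs,
      abs_of_pos (by positivity)]
    field_simp
  refine ⟨Metric.sphere z r' ∪ segment ℝ y' y, union_subset hS ?_, Or.inl hx₀,
    Or.inr (right_mem_segment ℝ y' y),
    hSc.union y' hy'S (left_mem_segment ℝ y' y) (convex_segment y' y).isPreconnected⟩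
  intro p hp
  refine ⟨hD.segment_subset (hS hy'S).1 hy.1 hp, fun hpr => ?_⟩
  obtain ⟨α, β, hα, hβ, hαβ, rfl⟩ := hp
  have e : α • y' + β • y - z = (α * (r' / dist y z) + β) • (y - z) := by
    obtain rfl : β = 1 - α := by linarith
    rw [hy']; module
  have h1 : dist (α • y' + β • y) z ≤ r := hpr
  rw [dist_eq_norm, e, norm_smul, ← dist_eq_norm, Real.norm_eq_abs, abs_of_nonneg (by positivity),
    add_mul, mul_assoc, div_mul_cancel₀ _ hyd0.ne'] at h1
  have h2 : r = α * r + β * r := by rw [← add_mul, hαβ, one_mul]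
  have h3 := mul_le_mul_of_nonneg_left hrr'.le hα
  have h4 := mul_le_mul_of_nonneg_left hyd.le hβ
  rcases hα.eq_or_lt with rfl | hα'
  · obtain rfl : β = 1 := by linarith
    linarith
  · have := mul_lt_mul_of_pos_left hrr' hα'
    linarith

/-- The open elliptic region with semi-axes `b₁`, `b₂`, from which the closed disc of radius `r`
about `z` is removed. -/
def perforatedEllipse (b₁ b₂ : ℝ) (z : Plane) (r : ℝ) : Set Plane :=
  ellipseRegion b₁ b₂ \ Metric.closedBall z r

/-- The quadratic form whose open unit sublevel set is the elliptic region. -/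
noncomputable def ellipseForm (b₁ b₂ : ℝ) : Plane → ℝ := quad (1 / b₁ ^ 2) (1 / b₂ ^ 2) 0 0 0

theorem mem_ellipseRegion_iff {b₁ b₂ : ℝ} {p : Plane} :
    p ∈ ellipseRegion b₁ b₂ ↔ ellipseForm b₁ b₂ p < 1 := by
  simp only [ellipseRegion, ellipseForm, quad, mem_ofPred_eq]
  ring_nf

theorem continuous_ellipseForm (b₁ b₂ : ℝ) : Continuous (ellipseForm b₁ b₂) :=
  (contDiff_quad (n := 2) ..).continuous

theorem isOpen_ellipseRegion (b₁ b₂ : ℝ) : IsOpen (ellipseRegion b₁ b₂) := by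
  have : ellipseRegion b₁ b₂ = {p | ellipseForm b₁ b₂ p < 1} :=
    Set.ext fun p => mem_ellipseRegion_iff
  rw [this]
  exact isOpen_lt (continuous_ellipseForm b₁ b₂) continuous_const

theorem convex_ellipseRegion (b₁ b₂ : ℝ) : Convex ℝ (ellipseRegion b₁ b₂) := by
  intro x hx y hy α β hα hβ hαβ
  rw [mem_ellipseRegion_iff] at *
  obtain rfl : β = 1 - α := by linarith
  have e : ellipseForm b₁ b₂ (α • x + (1 - α) • y) = α * ellipseForm b₁ b₂ x +
      (1 - α) * ellipseForm b₁ b₂ y - α * (1 - α) * ellipseForm b₁ b₂ (x - y) := by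
    simp [ellipseForm, quad]; ring
  have h0 : 0 ≤ ellipseForm b₁ b₂ (x - y) := by
    simp only [ellipseForm, quad, zero_mul, add_zero]; positivity
  have h1 := mul_nonneg (mul_nonneg hα hβ) h0
  rcases hα.eq_or_lt with rfl | hα'
  · simpa using hy
  · nlinarith [mul_lt_mul_of_pos_left hx hα', mul_le_mul_of_nonneg_left hy.le hβ]

theorem isBounded_ellipseRegion {b₁ b₂ : ℝ} (h₁ : 0 < b₁) (h₂ : 0 < b₂) :
    Bornology.IsBounded (ellipseRegion b₁ b₂) := by
  refine (Metric.isBounded_closedBall (x := (0 : Plane)) (r := b₁ + b₂)).subset fun p hp => ?_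
  have hp : p 0 ^ 2 / b₁ ^ 2 + p 1 ^ 2 / b₂ ^ 2 < 1 := hp
  have e0 : p 0 ^ 2 ≤ b₁ ^ 2 := by
    rw [← div_le_one (by positivity)]
    have : 0 ≤ p 1 ^ 2 / b₂ ^ 2 := by positivity
    linarith
  have e1 : p 1 ^ 2 ≤ b₂ ^ 2 := by
    rw [← div_le_one (by positivity)]
    have : 0 ≤ p 0 ^ 2 / b₁ ^ 2 := by positivity
    linarith
  rw [mem_closedBall_zero_iff]
  refine le_of_sq_le_sq ?_ (by positivity)
  rw [EuclideanSpace.norm_sq_eq, Fin.sum_univ_two]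
  simp only [Real.norm_eq_abs, sq_abs]
  nlinarith

section Domain

variable {b₁ b₂ r : ℝ} {z : Plane}

theorem isOpen_perforatedEllipse : IsOpen (perforatedEllipse b₁ b₂ z r) :=
  (isOpen_ellipseRegion b₁ b₂).sdiff Metric.isClosed_closedBall

theorem isBounded_perforatedEllipse (h₁ : 0 < b₁) (h₂ : 0 < b₂) :
    Bornology.IsBounded (perforatedEllipse b₁ b₂ z r) :=
  (isBounded_ellipseRegion h₁ h₂).subset sdiff_subset

theorem lt_dist_of_mem {x : Plane} (hx : x ∈ perforatedEllipse b₁ b₂ z r) : r < dist x z := by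
  by_contra! h
  exact hx.2 h

theorem le_dist_of_mem_closure {x : Plane} (hx : x ∈ closure (perforatedEllipse b₁ b₂ z r)) :
    r ≤ dist x z :=
  le_on_closure (f := fun _ => r) (g := fun y => dist y z) (fun _ hy => (lt_dist_of_mem hy).le)
    continuousOn_const (by fun_prop) hx

theorem ellipseForm_le_one_of_mem_closure {x : Plane}
    (hx : x ∈ closure (perforatedEllipse b₁ b₂ z r)) : ellipseForm b₁ b₂ x ≤ 1 :=
  le_on_closure (f := ellipseForm b₁ b₂) (g := fun _ => 1)
    (fun _ hy => (mem_ellipseRegion_iff.1 hy.1).le)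
    (continuous_ellipseForm b₁ b₂).continuousOn continuousOn_const hx

theorem notMem_of_mem_frontier {x : Plane} (hx : x ∈ frontier (perforatedEllipse b₁ b₂ z r)) :
    x ∉ perforatedEllipse b₁ b₂ z r := by
  rw [isOpen_perforatedEllipse.frontier_eq] at hx
  exact hx.2

theorem isPreconnected_perforatedEllipse {c : ℝ} (hr : 0 < r) (hrc : r < c)
    (hball : Metric.ball z c ⊆ ellipseRegion b₁ b₂) :
    IsPreconnected (perforatedEllipse b₁ b₂ z r) :=
  isPreconnected_diff_closedBall (convex_ellipseRegion b₁ b₂) hr.le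
    (show r < (r + c) / 2 by linarith)
    ((Metric.closedBall_subset_ball (by linarith)).trans hball)

/-! ### Reflections in lines -/

/-- Reflections in lines perpendicular to a semi-axis `n` of an ellipse with a hole: the lines move
from the tangent at the end of the semi-axis, of length `B`, halfway towards the hole, where the
reflection of the vertex reaches it. -/
theorem isMovingFamily_line {c B : ℝ} {n : Plane} (h₁ : 0 < b₁) (h₂ : 0 < b₂) (hr : 0 < r)
    (hrc : r < c) (hball : Metric.ball z c ⊆ ellipseRegion b₁ b₂) (hn : n 0 ^ 2 + n 1 ^ 2 = 1)
    (hB : (n 1 = 0 ∧ B = b₁) ∨ (n 0 = 0 ∧ B = b₂)) (hpos : 0 < B + inner ℝ n z + r) :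
    IsMovingFamily (perforatedEllipse b₁ b₂ z r) (quad 0 0 (-n 0) (-n 1) 0)
      (quad (-(1 / b₁ ^ 2)) (-(1 / b₂ ^ 2)) 0 0 1)
      (fun t x => x + (2 * (quad 0 0 (-n 0) (-n 1) 0 x - t)) • n)
      (-B) (-((B + inner ℝ n z + r) / 2)) := by
  have hn1 : ‖n‖ = 1 := by
    rw [← sq_eq_sq₀ (norm_nonneg _) zero_le_one, EuclideanSpace.norm_sq_eq, Fin.sum_univ_two]
    simpa using hn
  have hτ : ∀ x, quad 0 0 (-n 0) (-n 1) 0 x = -inner ℝ n x := fun x => by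
    simp [quad, PiLp.inner_apply, Fin.sum_univ_two]; ring
  have hη : ∀ x, quad (-(1 / b₁ ^ 2)) (-(1 / b₂ ^ 2)) 0 0 1 x = 1 - ellipseForm b₁ b₂ x := by
    intro x
    simp [quad, ellipseForm]; ring
  have hB0 : 0 < B := by rcases hB with ⟨-, rfl⟩ | ⟨-, rfl⟩ <;> assumption
  set β := 1 / B ^ 2 with hβ
  have hβ0 : 0 < β := by positivity
  have hβB : β * B ^ 2 = 1 := by rw [hβ]; field_simp
  have hform : ∀ (x : Plane) (μ : ℝ), ellipseForm b₁ b₂ (x + μ • n) =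
      ellipseForm b₁ b₂ x + β * (2 * μ * inner ℝ n x + μ ^ 2) := by
    intro x μ
    rcases hB with ⟨h, rfl⟩ | ⟨h, rfl⟩ <;>
    · simp only [h, ne_eq, OfNat.ofNat_ne_zero, not_false_eq_true, zero_pow, add_zero, zero_add] at hn
      simp [ellipseForm, quad, PiLp.inner_apply, Fin.sum_univ_two, h, hβ]
      linear_combination (μ ^ 2 * (B ^ 2)⁻¹) * hn
  have hinner : ∀ x, β * inner ℝ n x ^ 2 ≤ ellipseForm b₁ b₂ x := by
    intro x
    rcases hB with ⟨h, rfl⟩ | ⟨h, rfl⟩ <;>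
    · simp only [h, ne_eq, OfNat.ofNat_ne_zero, not_false_eq_true, zero_pow, add_zero, zero_add] at hn
      simp [ellipseForm, quad, PiLp.inner_apply, Fin.sum_univ_two, h, hβ, mul_pow, hn]
      positivity
  have hgrad : ∀ x, 4 * β ^ 2 * inner ℝ n x ^ 2 ≤
      ‖gradient (quad (-(1 / b₁ ^ 2)) (-(1 / b₂ ^ 2)) 0 0 1) x‖ ^ 2 := by
    intro x
    rw [norm_gradient_quad_sq]
    rcases hB with ⟨h, rfl⟩ | ⟨h, rfl⟩
    · simp only [h, ne_eq, OfNat.ofNat_ne_zero, not_false_eq_true, zero_pow, add_zero] at hn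
      simp [PiLp.inner_apply, Fin.sum_univ_two, h, hβ, mul_pow, hn]
      have : 0 ≤ ((b₂ ^ 2) ^ 2)⁻¹ * x 1 ^ 2 := by positivity
      linarith
    · simp only [h, ne_eq, OfNat.ofNat_ne_zero, not_false_eq_true, zero_pow, zero_add] at hn
      simp [PiLp.inner_apply, Fin.sum_univ_two, h, hβ, mul_pow, hn]
      have : 0 ≤ ((b₁ ^ 2) ^ 2)⁻¹ * x 0 ^ 2 := by positivity
      linarith
  have hlt : ∀ x ∈ ellipseRegion b₁ b₂, inner ℝ n x < B := fun x hx => by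
    have h1 := (hinner x).trans_lt (mem_ellipseRegion_iff.1 hx)
    rw [← hβB] at h1
    exact lt_of_pow_lt_pow_left₀ 2 hB0.le (lt_of_mul_lt_mul_left h1 hβ0.le)
  have hle : ∀ x, ellipseForm b₁ b₂ x ≤ 1 → inner ℝ n x ≤ B := fun x hx => by
    have h1 := (hinner x).trans hx
    rw [← hβB] at h1
    exact le_of_sq_le_sq (le_of_mul_le_mul_left h1 hβ0) hB0.le
  have hdist : ∀ x, inner ℝ n z + r < inner ℝ n x → x ∉ Metric.closedBall z r := fun x hx hx' => by
    have h1 := real_inner_le_norm n (x - z)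
    rw [hn1, one_mul, ← dist_eq_norm, inner_sub_right] at h1
    have h2 : dist x z ≤ r := hx'
    linarith
  have hzB : inner ℝ n z + r < B := by
    have h1 := hlt (z + r • n) (hball (by simp [norm_smul, hn1, abs_of_pos hr, hrc]))
    rw [inner_add_right, inner_smul_right, real_inner_self_eq_norm_sq, hn1] at h1
    linarith
  have hinT : ∀ (t : ℝ) x, inner ℝ n (x + (2 * (-inner ℝ n x - t)) • n) =
      -2 * t - inner ℝ n x := fun t x => by
    rw [inner_add_right, inner_smul_right, real_inner_self_eq_norm_sq, hn1]; ring
  have hTc : ∀ t, ContDiff ℝ 2 (fun x => x + (2 * (quad 0 0 (-n 0) (-n 1) 0 x - t)) • n) :=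
    fun t => contDiff_id.add ((contDiff_const.mul ((contDiff_quad ..).sub contDiff_const)).smul
      contDiff_const)
  have hcap : ∀ t ≤ -((B + inner ℝ n z + r) / 2), {x | x ∈ perforatedEllipse b₁ b₂ z r ∧
      quad 0 0 (-n 0) (-n 1) 0 x < t} = ellipseRegion b₁ b₂ ∩ {x | -t < inner ℝ n x} := by
    intro t ht
    ext x
    simp only [hτ, mem_ofPred_eq, mem_inter_iff]
    constructor
    · exact fun h => ⟨h.1.1, by linarith [h.2]⟩
    · exact fun h => ⟨⟨h.1, hdist x (by linarith [h.2])⟩, by linarith [h.2]⟩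
  refine
    { contDiff_level := contDiff_quad ..
      contDiff_depth := contDiff_quad ..
      le_level := fun x hx => ?_
      continuousAt := fun t x _ => ?_
      contDiffAt := fun t _ x _ => (hTc t).contDiffAt
      mapsTo := fun t ht x hx hxt => ?_
      fixed := fun t x _ hxt => by simp [hxt]
      conformal := fun t ht x hx hxt => ⟨1, le_rfl, (Submodule.span ℝ {n})ᗮ.reflection, ?_⟩
      gradient_bound := ?_
      laplacian_bound := ⟨0, le_rfl, fun x => ?_⟩
      depth_nonneg := fun x hx => ?_
      depth_frontier := fun x hx hxt => ?_
      isPreconnected := fun t ht => ?_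
      interior_ball := fun x hx ε hε => ?_
      exists_moved := fun t ht => ?_ }
  · rw [hτ]
    have := hle x (ellipseForm_le_one_of_mem_closure hx)
    linarith
  · have hq : Continuous (quad 0 0 (-n 0) (-n 1) 0) := (contDiff_quad (n := 2) ..).continuous
    have : Continuous fun q : ℝ × Plane =>
        q.2 + (2 * (quad 0 0 (-n 0) (-n 1) 0 q.2 - q.1)) • n := by fun_prop
    exact this.continuousAt
  · rw [hτ] at hxt ⊢
    have h3 := hlt x hx.1
    refine ⟨mem_ellipseRegion_iff.2 ?_, hdist _ ?_⟩
    · have h4 := mem_ellipseRegion_iff.1 hx.1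
      rw [hform]
      have : 2 * (2 * (-inner ℝ n x - t)) * inner ℝ n x + (2 * (-inner ℝ n x - t)) ^ 2 =
        4 * t * (t + inner ℝ n x) := by ring
      rw [this]
      have h5 : t * (t + inner ℝ n x) ≤ 0 :=
        mul_nonpos_of_nonpos_of_nonneg (by linarith [ht.2]) (by linarith)
      nlinarith
    · rw [hinT]; linarith [ht.2]
  · have hd : ∀ y, HasFDerivAt (fun x => x + (2 * (quad 0 0 (-n 0) (-n 1) 0 x - t)) • n)
        (ContinuousLinearMap.id ℝ Plane + ((2 : ℝ) • -(innerSL ℝ n)).smulRight n) y := by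
      intro y
      have h6 : HasFDerivAt (quad 0 0 (-n 0) (-n 1) 0) (-(innerSL ℝ n)) y := by
        have : quad 0 0 (-n 0) (-n 1) 0 = fun x => (-(innerSL ℝ n)) x := by
          ext x; simp [hτ]
        rw [this]
        exact ContinuousLinearMap.hasFDerivAt _
      exact (hasFDerivAt_id y).add (((h6.sub_const t).const_mul 2).smul_const n)
    constructor
    · intro h
      rw [(hd x).fderiv, Submodule.reflection_orthogonal_apply, Submodule.reflection_singleton_apply]
      simp [hn1]
      module
    · rw [laplacian_eq_sum_fderiv_fderiv (EuclideanSpace.basisFun (Fin 2) ℝ)]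
      have : fderiv ℝ (fun x => x + (2 * (quad 0 0 (-n 0) (-n 1) 0 x - t)) • n) =
        fun _ => ContinuousLinearMap.id ℝ Plane + ((2 : ℝ) • -(innerSL ℝ n)).smulRight n :=
        funext fun y => (hd y).fderiv
      rw [this]
      simp
  · refine ⟨min 1 (4 * β ^ 2 * ((B + inner ℝ n z + r) / 2) ^ 2), by positivity, fun x hx hxt => ?_⟩
    rw [hτ] at hxt
    constructor
    · rw [norm_gradient_quad_sq]
      refine (min_le_left _ _).trans (le_of_eq ?_)
      rw [← hn]; ring
    · refine (min_le_right _ _).trans (le_trans ?_ (hgrad x))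
      gcongr
      linarith
  · simp only [laplacian_quad]
    have := one_div_nonneg.2 (sq_nonneg b₁)
    have := one_div_nonneg.2 (sq_nonneg b₂)
    constructor <;> linarith
  · rw [hη]
    linarith [ellipseForm_le_one_of_mem_closure hx]
  · rw [hη]
    rw [hτ] at hxt
    by_contra! h
    exact notMem_of_mem_frontier hx
      ⟨mem_ellipseRegion_iff.2 (by linarith), hdist x (by linarith)⟩
  · rw [hcap t ht.2]
    exact ((convex_ellipseRegion b₁ b₂).inter
      (convex_halfSpace_gt (innerSL ℝ n).isLinear (-t))).isPreconnected
  · refine ⟨x + (ε / 2) • n, ε / 2, by linarith, by linarith, ?_, fun y hy => ?_⟩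
    · simp [norm_smul, hn1, abs_of_pos hε]
    · rw [hτ, hτ]
      have h1 := (abs_le.1 (abs_real_inner_le_norm n (y - (x + (ε / 2) • n)))).1
      rw [hn1, one_mul, ← dist_eq_norm, inner_sub_right, inner_add_right, inner_smul_right,
        real_inner_self_eq_norm_sq, hn1] at h1
      have h2 : dist y (x + (ε / 2) • n) < ε / 2 := hy
      linarith
  · -- a point of the ellipse strictly between the mirror and the vertex
    have hℓ : (B + inner ℝ n z + r) / 2 ≤ -t := by linarith [ht.2]
    have hℓB : -t < B := by linarith [ht.1]
    obtain ⟨y, hy1, hyn⟩ : ∃ y, ellipseForm b₁ b₂ y = 1 ∧ inner ℝ n y = (-t + B) / 2 := by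
      have h0 : 0 ≤ 1 - ((-t + B) / 2) ^ 2 / B ^ 2 := by
        rw [sub_nonneg, div_le_one (by positivity)]
        gcongr
        · linarith
        · linarith
      rcases hB with ⟨h, rfl⟩ | ⟨h, rfl⟩
      · refine ⟨!₂[n 0 * ((-t + B) / 2), b₂ * √(1 - ((-t + B) / 2) ^ 2 / B ^ 2)], ?_, ?_⟩
        · simp only [h, ne_eq, OfNat.ofNat_ne_zero, not_false_eq_true, zero_pow, add_zero] at hn
          simp only [ellipseForm, quad, Matrix.cons_val_zero, Matrix.cons_val_one,
            Matrix.cons_val_fin_one, mul_pow, Real.sq_sqrt h0, hn]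
          field_simp
          ring
        · simp [h] at hn
          simp [PiLp.inner_apply, Fin.sum_univ_two, h]
          rcases hn with hn | hn <;> simp [hn]
      · refine ⟨!₂[b₁ * √(1 - ((-t + B) / 2) ^ 2 / B ^ 2), n 1 * ((-t + B) / 2)], ?_, ?_⟩
        · simp only [h, ne_eq, OfNat.ofNat_ne_zero, not_false_eq_true, zero_pow, zero_add] at hn
          simp only [ellipseForm, quad, Matrix.cons_val_zero, Matrix.cons_val_one,
            Matrix.cons_val_fin_one, mul_pow, Real.sq_sqrt h0, hn]
          field_simp
          ring
        · simp [h] at hn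
          simp [PiLp.inner_apply, Fin.sum_univ_two, h]
          rcases hn with hn | hn <;> simp [hn]
    have hyE : y ∈ closure (ellipseRegion b₁ b₂) := by
      have h5 : Tendsto (fun θ : ℝ => θ • y) (𝓝[<] 1) (𝓝 y) := by
        have : ContinuousAt (fun θ : ℝ => θ • y) 1 := by fun_prop
        simpa [ContinuousAt] using this.mono_left nhdsWithin_le_nhds
      refine mem_closure_of_tendsto h5 ?_
      filter_upwards [Ioo_mem_nhdsLT (zero_lt_one' ℝ)] with θ hθ
      have e : ellipseForm b₁ b₂ (θ • y) = θ ^ 2 * ellipseForm b₁ b₂ y := by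
        simp [ellipseForm, quad]; ring
      rw [mem_ellipseRegion_iff, e, hy1]
      nlinarith [hθ.1, hθ.2]
    refine ⟨y, ?_, by rw [hτ]; linarith, ?_⟩
    · rw [isOpen_perforatedEllipse.frontier_eq]
      refine ⟨?_, fun h => ?_⟩
      · have : y ∈ closure ((Metric.closedBall z r)ᶜ ∩ ellipseRegion b₁ b₂) :=
          Metric.isClosed_closedBall.isOpen_compl.inter_closure
            ⟨hdist y (by linarith), hyE⟩
        rwa [inter_comm] at this
      · exact absurd (mem_ellipseRegion_iff.1 h.1) (by linarith)
    · rw [hτ]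
      refine ⟨mem_ellipseRegion_iff.2 ?_, hdist _ ?_⟩
      · rw [hform, hy1, hyn]
        have : 2 * (2 * (-((-t + B) / 2) - t)) * ((-t + B) / 2) + (2 * (-((-t + B) / 2) - t)) ^ 2 =
          2 * (t * (t + B)) := by ring
        rw [this]
        have : t * (t + B) < 0 := mul_neg_of_neg_of_pos (by linarith) (by linarith)
        nlinarith
      · rw [hinT]; linarith

/-! ### Inversions in circles -/

/-- Inversions in the circles about the centre of the hole: the radius grows from the radius `r` of
the hole to `√(r c)`, where the image of the boundary of the hole is the circle of radius `c`. -/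
theorem isMovingFamily_inversion {c : ℝ} (hr : 0 < r) (hrc : r < c)
    (hball : Metric.ball z c ⊆ ellipseRegion b₁ b₂)
    (hy₀ : ∃ y₀ ∈ ellipseRegion b₁ b₂, dist y₀ z = c) :
    IsMovingFamily (perforatedEllipse b₁ b₂ z r)
      (quad 1 1 (-2 * z 0) (-2 * z 1) (z 0 ^ 2 + z 1 ^ 2))
      (quad 1 1 (-2 * z 0) (-2 * z 1) (z 0 ^ 2 + z 1 ^ 2 - r ^ 2))
      (fun t => EuclideanGeometry.inversion z √t) (r ^ 2) (r * c) := by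
  have hc : 0 < c := hr.trans hrc
  have hτ : ∀ x, quad 1 1 (-2 * z 0) (-2 * z 1) (z 0 ^ 2 + z 1 ^ 2) x = dist x z ^ 2 := fun x => by
    rw [dist_eq_norm, norm_sub_sq_eq_quad]
  have hη : ∀ x, quad 1 1 (-2 * z 0) (-2 * z 1) (z 0 ^ 2 + z 1 ^ 2 - r ^ 2) x =
      dist x z ^ 2 - r ^ 2 := fun x => by
    rw [← hτ]; simp only [quad]; ring
  have hrc2 : r * c < c ^ 2 := by nlinarith
  have hballE : ∀ x, dist x z < c → x ∈ ellipseRegion b₁ b₂ := fun x hx => hball hx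
  have hne : ∀ x ∈ closure (perforatedEllipse b₁ b₂ z r), x ≠ z := fun x hx h => by
    have := le_dist_of_mem_closure hx
    rw [h, dist_self] at this
    linarith
  have hlt : ∀ {x} {t : ℝ}, 0 ≤ t → dist x z ^ 2 < t → dist x z < √t := fun ht h =>
    (Real.lt_sqrt dist_nonneg).2 h
  have ht0 : ∀ t ∈ Icc (r ^ 2) (r * c), 0 < t := fun t ht => lt_of_lt_of_le (by positivity) ht.1
  have hsq : ∀ {t : ℝ}, t ≤ r * c → √t < c := fun {t} ht => by
    rw [Real.sqrt_lt' hc]; linarith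
  refine
    { contDiff_level := contDiff_quad ..
      contDiff_depth := contDiff_quad ..
      le_level := fun x hx => ?_
      continuousAt := fun t x hx => ?_
      contDiffAt := fun t _ x hx => contDiffAt_const.inversion contDiffAt_const contDiffAt_id
        (hne x (subset_closure hx))
      mapsTo := fun t ht x hx hxt => ?_
      fixed := fun t x hx hxt => ?_
      conformal := fun t ht x hx hxt => ?_
      gradient_bound := ⟨4 * r ^ 2, by positivity, fun x hx _ => ?_⟩
      laplacian_bound := ⟨4, by norm_num, fun x => ?_⟩
      depth_nonneg := fun x hx => ?_
      depth_frontier := fun x hx hxt => ?_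
      isPreconnected := fun t ht => ?_
      interior_ball := fun x hx ε hε => ?_
      exists_moved := fun t ht => ?_ }
  · rw [hτ]
    have := le_dist_of_mem_closure hx
    gcongr
  · have hd : dist x z ≠ 0 := dist_ne_zero.2 (hne x hx)
    have h1 : ContinuousAt (fun q : ℝ × Plane =>
        (√q.1 / dist q.2 z) ^ 2 • (q.2 - z) + z) (t, x) :=
      ((((by fun_prop : ContinuousAt (fun q : ℝ × Plane => √q.1) (t, x)).div
        (by fun_prop) hd).pow 2).smul (by fun_prop)).add (by fun_prop)
    exact h1
  · rw [hτ] at hxt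
    have hd := lt_dist_of_mem hx
    have hd0 : 0 < dist x z := hr.trans hd
    have ht' := ht0 t ht
    have hdT : dist (EuclideanGeometry.inversion z √t x) z = t / dist x z := by
      rw [EuclideanGeometry.dist_inversion_center, Real.sq_sqrt ht'.le]
    refine ⟨hballE _ ?_, fun h => ?_⟩
    · rw [hdT, div_lt_iff₀ hd0]
      nlinarith [ht.2]
    · have h1 : dist (EuclideanGeometry.inversion z √t x) z ≤ r := h
      rw [hdT, div_le_iff₀ hd0] at h1
      nlinarith
  · rw [hτ] at hxt
    have : √t = dist x z := by rw [← hxt, Real.sqrt_sq dist_nonneg]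
    rw [this]
    exact EuclideanGeometry.inversion_dist_center z x
  · rw [hτ] at hxt
    have hd0 : 0 < dist x z := hr.trans (lt_dist_of_mem hx)
    have hxz := hne x (subset_closure hx)
    refine ⟨(√t / dist x z) ^ 2, ?_, (Submodule.span ℝ {x - z})ᗮ.reflection, fun h => ?_,
      laplacian_inversion hxz _⟩
    · rw [div_pow, Real.sq_sqrt (ht0 t ht).le, one_le_div (by positivity)]
      exact hxt.le
    · rw [(EuclideanGeometry.hasFDerivAt_inversion hxz).fderiv]
      simp
  · have h1 := lt_dist_of_mem hx
    have h2 : r ^ 2 ≤ dist x z ^ 2 := by gcongr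
    have e : ∀ k, ‖gradient (quad 1 1 (-2 * z 0) (-2 * z 1) k) x‖ ^ 2 = 4 * dist x z ^ 2 := by
      intro k
      rw [norm_gradient_quad_sq, ← hτ]; simp only [quad]; ring
    rw [e, e]
    constructor <;> linarith
  · simp only [laplacian_quad]; norm_num
  · rw [hη]
    have h1 := le_dist_of_mem_closure hx
    have h2 : r ^ 2 ≤ dist x z ^ 2 := by gcongr
    linarith
  · rw [hτ] at hxt
    rw [hη]
    by_contra! h
    refine notMem_of_mem_frontier hx
      ⟨hballE x (lt_of_pow_lt_pow_left₀ 2 hc.le (by linarith)), fun h1 => ?_⟩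
    have h2 : dist x z ≤ r := h1
    have h3 : dist x z ^ 2 ≤ r ^ 2 := by gcongr
    linarith
  · have ht' := ht0 t ht
    rcases ht.1.eq_or_lt with h | h
    · have : {x | x ∈ perforatedEllipse b₁ b₂ z r ∧
          quad 1 1 (-2 * z 0) (-2 * z 1) (z 0 ^ 2 + z 1 ^ 2) x < t} = ∅ := by
        ext x
        simp only [hτ, mem_ofPred_eq, mem_empty_iff_false, iff_false, not_and, not_lt]
        intro hx
        have := (lt_dist_of_mem hx).le
        rw [← h]; gcongr
      rw [this]; exact isPreconnected_empty
    · have e : {x | x ∈ perforatedEllipse b₁ b₂ z r ∧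
          quad 1 1 (-2 * z 0) (-2 * z 1) (z 0 ^ 2 + z 1 ^ 2) x < t} =
          Metric.ball z √t \ Metric.closedBall z r := by
        ext x
        simp only [hτ, mem_ofPred_eq]
        constructor
        · exact fun hx => ⟨hlt ht'.le hx.2, hx.1.2⟩
        · exact fun hx => ⟨⟨hballE x ((show dist x z < √t from hx.1).trans (hsq ht.2)), hx.2⟩,
            (Real.lt_sqrt dist_nonneg).1 hx.1⟩
      have hrt : r < √t := (Real.lt_sqrt hr.le).2 h
      rw [e]
      exact isPreconnected_diff_closedBall (convex_ball z √t) hr.le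
        (show r < (r + √t) / 2 by linarith) (Metric.closedBall_subset_ball (by linarith))
  · have hd0 : 0 < dist x z := hr.trans (lt_dist_of_mem hx)
    obtain ⟨ρ, hρ0, hρ⟩ := exists_between (lt_min hε hd0)
    have hρε := hρ.trans_le (min_le_left _ _)
    have hρd := hρ.trans_le (min_le_right _ _)
    have hq1 : dist x (x + (ρ / dist x z) • (z - x)) = ρ := by
      rw [dist_self_add_right, norm_smul, ← dist_eq_norm, dist_comm z x, Real.norm_eq_abs,
        abs_of_pos (by positivity)]
      field_simp
    have hq2 : dist (x + (ρ / dist x z) • (z - x)) z = dist x z - ρ := by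
      have e : x + (ρ / dist x z) • (z - x) - z = (1 - ρ / dist x z) • (x - z) := by module
      have h1 : ρ / dist x z < 1 := (div_lt_one hd0).2 hρd
      rw [dist_eq_norm, e, norm_smul, Real.norm_eq_abs, abs_of_pos (by linarith), ← dist_eq_norm]
      field_simp
    refine ⟨_, ρ, hρ0, hρε, hq1, fun y hy => ?_⟩
    rw [hτ, hτ]
    have h1 : dist y (x + (ρ / dist x z) • (z - x)) < ρ := hy
    have h2 := dist_triangle y (x + (ρ / dist x z) • (z - x)) z
    have h3 : dist y z < dist x z := by linarith
    gcongr
  · obtain ⟨y₀, hy₀E, hy₀c⟩ := hy₀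
    have ht' := ht0 t ⟨ht.1.le, ht.2⟩
    have hyz : dist (z + (r / c) • (y₀ - z)) z = r := by
      rw [dist_self_add_left, norm_smul, ← dist_eq_norm, hy₀c, Real.norm_eq_abs,
        abs_of_pos (by positivity)]
      field_simp
    have hTy : EuclideanGeometry.inversion z √t (z + (r / c) • (y₀ - z)) =
        (t / (r * c)) • y₀ + (1 - t / (r * c)) • z := by
      have e : t / r ^ 2 * (r / c) = t / (r * c) := by field_simp
      rw [EuclideanGeometry.inversion, hyz, div_pow, Real.sq_sqrt ht'.le]
      simp only [vsub_eq_sub, vadd_eq_add, add_sub_cancel_left, smul_smul, e]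
      module
    have hTd : dist (EuclideanGeometry.inversion z √t (z + (r / c) • (y₀ - z))) z = t / r := by
      rw [EuclideanGeometry.dist_inversion_center, hyz, Real.sq_sqrt ht'.le]
    refine ⟨z + (r / c) • (y₀ - z), ?_, ?_, ?_, fun h => ?_⟩
    · rw [isOpen_perforatedEllipse.frontier_eq]
      refine ⟨?_, fun h => h.2 hyz.le⟩
      refine (isOpen_ellipseRegion b₁ b₂).inter_closure ⟨hballE _ (by rw [hyz]; exact hrc), ?_⟩
      show _ ∈ closure (Metric.closedBall z r)ᶜ
      rw [closure_compl, interior_closedBall z hr.ne']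
      exact fun h => (ne_of_lt (show dist _ z < r from h)) hyz
    · rw [hτ, hyz]; exact ht.1
    · rw [hTy]
      exact convex_ellipseRegion b₁ b₂ hy₀E (hballE z (by simpa using hc)) (by positivity)
        (sub_nonneg.2 ((div_le_one (by positivity)).2 ht.2)) (by ring)
    · have h1 : dist (EuclideanGeometry.inversion z √t (z + (r / c) • (y₀ - z))) z ≤ r := h
      rw [hTd, div_le_iff₀ hr] at h1
      nlinarith [ht.1]

end Domain

/-! ### Critical points -/

section Critical

variable {b₁ b₂ r c : ℝ} {z : Plane} {f : ℝ → ℝ} {u : Plane → ℝ}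

/-- The moving lines perpendicular to `n` sweep out no critical points. -/
theorem inner_lt_of_mem_criticalSet {B : ℝ} {n : Plane} (h₁ : 0 < b₁) (h₂ : 0 < b₂) (hr : 0 < r)
    (hrc : r < c) (hball : Metric.ball z c ⊆ ellipseRegion b₁ b₂) (hn : n 0 ^ 2 + n 1 ^ 2 = 1)
    (hB : (n 1 = 0 ∧ B = b₁) ∨ (n 0 = 0 ∧ B = b₂)) (hpos : 0 < B + inner ℝ n z + r)
    (hf : LocallyLipschitz f) (hu : IsDirichletSolution f (perforatedEllipse b₁ b₂ z r) u)
    (hnc : IsNonconstantOn u (perforatedEllipse b₁ b₂ z r))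
    (hf0 : ∀ p ∈ perforatedEllipse b₁ b₂ z r, 0 ≤ f (u p)) {p : Plane}
    (hp : p ∈ criticalSet u (perforatedEllipse b₁ b₂ z r)) :
    inner ℝ n p < (B + inner ℝ n z + r) / 2 := by
  have hΩ : IsOpen (perforatedEllipse b₁ b₂ z r) := isOpen_perforatedEllipse
  have hb := isBounded_perforatedEllipse (r := r) (z := z) h₁ h₂
  have hu0 := pos_of_isNonconstantOn hΩ (isPreconnected_perforatedEllipse hr hrc hball) hb hu
    hf0 hnc
  by_contra! h
  refine (isMovingFamily_line h₁ h₂ hr hrc hball hn hB hpos).gradient_ne_zero hΩ hf hb hu hf0 hu0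
    hp.1 ?_ hp.2
  have : quad 0 0 (-n 0) (-n 1) 0 p = -inner ℝ n p := by
    simp [quad, PiLp.inner_apply, Fin.sum_univ_two]; ring
  rw [this]
  linarith

/-- The moving circles about the centre of the hole sweep out no critical points. -/
theorem lt_dist_sq_of_mem_criticalSet (h₁ : 0 < b₁) (h₂ : 0 < b₂) (hr : 0 < r)
    (hrc : r < c) (hball : Metric.ball z c ⊆ ellipseRegion b₁ b₂)
    (hy₀ : ∃ y₀ ∈ ellipseRegion b₁ b₂, dist y₀ z = c)
    (hf : LocallyLipschitz f) (hu : IsDirichletSolution f (perforatedEllipse b₁ b₂ z r) u)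
    (hnc : IsNonconstantOn u (perforatedEllipse b₁ b₂ z r))
    (hf0 : ∀ p ∈ perforatedEllipse b₁ b₂ z r, 0 ≤ f (u p)) {p : Plane}
    (hp : p ∈ criticalSet u (perforatedEllipse b₁ b₂ z r)) :
    r * c < dist p z ^ 2 := by
  have hΩ : IsOpen (perforatedEllipse b₁ b₂ z r) := isOpen_perforatedEllipse
  have hb := isBounded_perforatedEllipse (r := r) (z := z) h₁ h₂
  have hu0 := pos_of_isNonconstantOn hΩ (isPreconnected_perforatedEllipse hr hrc hball) hb hu
    hf0 hnc
  by_contra! h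
  refine (isMovingFamily_inversion hr hrc hball hy₀).gradient_ne_zero hΩ hf hb hu hf0 hu0
    hp.1 ?_ hp.2
  rwa [← norm_sub_sq_eq_quad, ← dist_eq_norm]

/-- A disc in the ellipse is no wider than the ellipse is along either axis. -/
theorem inradius_ellipseRegion_le (h₁ : 0 < b₁) (h₂ : 0 < b₂) :
    inradius (ellipseRegion b₁ b₂) ≤ min b₁ b₂ := by
  refine csSup_le ⟨0, 0, by simp⟩ ?_
  rintro ρ ⟨p, hp⟩
  refine le_of_forall_lt fun t ht => ?_
  rcases lt_or_ge t 0 with h0 | h0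
  · exact h0.trans (lt_min h₁ h₂)
  have key : ∀ (i : Fin 2) (σ : ℝ), σ ^ 2 = 1 →
      p + (σ * t) • EuclideanSpace.single i (1 : ℝ) ∈ ellipseRegion b₁ b₂ := by
    intro i σ hσ
    refine hp ?_
    have : |σ| = 1 := by rwa [← sq_eq_sq₀ (abs_nonneg σ) zero_le_one, sq_abs, one_pow]
    simpa [norm_smul, abs_mul, this, abs_of_nonneg h0] using ht
  have sq_lt : ∀ {b x y : ℝ}, 0 < b → 0 ≤ y → x ^ 2 / b ^ 2 + y < 1 → |x| < b := by
    intro b x y hb hy h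
    rw [← sq_lt_sq₀ (abs_nonneg x) hb.le, sq_abs, ← div_lt_one (by positivity)]
    linarith
  refine lt_min ?_ ?_
  · have hp := key 0 1 (by norm_num)
    have hm := key 0 (-1) (by norm_num)
    simp only [ellipseRegion, mem_ofPred_eq] at hp hm
    have ap := (abs_lt.1 (sq_lt h₁ (by positivity) hp)).2
    have am := (abs_lt.1 (sq_lt h₁ (by positivity) hm)).1
    simp at ap am
    linarith
  · have hp := key 1 1 (by norm_num)
    have hm := key 1 (-1) (by norm_num)
    simp only [ellipseRegion, mem_ofPred_eq] at hp hm
    rw [add_comm] at hp hm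
    have ap := (abs_lt.1 (sq_lt h₂ (by positivity) hp)).2
    have am := (abs_lt.1 (sq_lt h₂ (by positivity) hm)).1
    simp at ap am
    linarith

theorem ball_eq_ellipseRegion {R : ℝ} (hR : 0 < R) :
    Metric.ball (0 : Plane) R = ellipseRegion R R := by
  ext p
  rw [mem_ball_zero_iff, ← sq_lt_sq₀ (norm_nonneg p) hR.le, EuclideanSpace.norm_sq_eq,
    Fin.sum_univ_two]
  simp only [Real.norm_eq_abs, sq_abs, ellipseRegion, mem_ofPred_eq]
  rw [← add_div, div_lt_one (by positivity)]

theorem ball_subset_ellipseRegion (h₁ : 0 < b₁) (h₂ : 0 < b₂) :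
    Metric.ball (0 : Plane) (min b₁ b₂) ⊆ ellipseRegion b₁ b₂ := by
  have hc : 0 < min b₁ b₂ := lt_min h₁ h₂
  rw [ball_eq_ellipseRegion hc]
  intro p hp
  have hp : p 0 ^ 2 / min b₁ b₂ ^ 2 + p 1 ^ 2 / min b₁ b₂ ^ 2 < 1 := hp
  refine lt_of_le_of_lt (add_le_add ?_ ?_) hp
  · gcongr; exact min_le_left _ _
  · gcongr; exact min_le_right _ _

theorem notMem_roundRing_of_lt_dist_sq {p : Plane} {k : ℝ} (hr : 0 ≤ r) (h : k < dist p z ^ 2) :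
    p ∉ roundRing z r √k := by
  rintro ⟨h1, h2⟩
  have := (Real.le_sqrt' (hr.trans_lt h1)).1 h2
  linarith

end Critical
end MovingPlanes

open MovingPlanes in
theorem theoremD (f : ℝ → ℝ) (hf : LocallyLipschitz f) :
    (∀ (a b₁ b₂ : ℝ) (u : Plane → ℝ),
      0 < a → a < b₁ → a < b₂ → b₁ ≠ b₂ →
      IsDirichletSolution f (ellipticPetalDomain a b₁ b₂) u →
      IsNonconstantOn u (ellipticPetalDomain a b₁ b₂) →
      (∀ p ∈ ellipticPetalDomain a b₁ b₂, 0 ≤ f (u p)) →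
      criticalSet u (ellipticPetalDomain a b₁ b₂) ⊆
        openBox (-((a + b₁) / 2)) ((a + b₁) / 2) (-((a + b₂) / 2)) ((a + b₂) / 2) ∩
          (ellipticPetalDomain a b₁ b₂ \
            roundRing 0 a (Real.sqrt (a * inradius (ellipseRegion b₁ b₂))))) ∧
    (∀ (a r R : ℝ) (u : Plane → ℝ),
      0 < a → 0 < r → a + r < R →
      IsDirichletSolution f (eccentricAnnulus a r R) u →
      IsNonconstantOn u (eccentricAnnulus a r R) →
      (∀ p ∈ eccentricAnnulus a r R, 0 ≤ f (u p)) →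
      criticalSet u (eccentricAnnulus a r R) ⊆
        openBox ((-R + a - r) / 2) ((a + r + R) / 2) (-R) R ∩
          (eccentricAnnulus a r R \
            roundRing !₂[a, 0] r (Real.sqrt (r * (R - a))))) := by
  refine ⟨fun a b₁ b₂ u ha hab₁ hab₂ hne hu hnc hf0 p hp => ?_,
    fun a r R u ha hr haR hu hnc hf0 p hp => ?_⟩
  · have e : ellipticPetalDomain a b₁ b₂ = perforatedEllipse b₁ b₂ 0 a := rfl
    rw [e] at hu hnc hf0 hp ⊢
    have h₁ : 0 < b₁ := ha.trans hab₁
    have h₂ : 0 < b₂ := ha.trans hab₂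
    have hball := ball_subset_ellipseRegion h₁ h₂
    have hac : a < min b₁ b₂ := lt_min hab₁ hab₂
    have hx : ∀ σ : ℝ, σ ^ 2 = 1 → σ * p 0 < (a + b₁) / 2 := fun σ hσ => by
      have := inner_lt_of_mem_criticalSet (n := !₂[σ, 0]) (B := b₁) h₁ h₂ ha hac hball
        (by simpa using hσ) (Or.inl ⟨by simp, rfl⟩) (by simp; positivity) hf hu hnc hf0 hp
      simp [PiLp.inner_apply, Fin.sum_univ_two] at this
      linarith
    have hy : ∀ σ : ℝ, σ ^ 2 = 1 → σ * p 1 < (a + b₂) / 2 := fun σ hσ => by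
      have := inner_lt_of_mem_criticalSet (n := !₂[0, σ]) (B := b₂) h₁ h₂ ha hac hball
        (by simpa using hσ) (Or.inr ⟨by simp, rfl⟩) (by simp; positivity) hf hu hnc hf0 hp
      simp [PiLp.inner_apply, Fin.sum_univ_two] at this
      linarith
    -- the vertices on the longer axis of the ellipse have images inside it
    have hy₀ : ∃ y₀ ∈ ellipseRegion b₁ b₂, dist y₀ 0 = min b₁ b₂ := by
      rcases hne.lt_or_gt with h | h
      · refine ⟨!₂[0, b₁], ?_, ?_⟩
        · simp only [ellipseRegion, Set.mem_ofPred_eq]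
          simp
          rw [div_lt_one (by positivity)]
          gcongr
        · simp [EuclideanSpace.norm_eq, Fin.sum_univ_two, min_eq_left h.le, h₁.le]
      · refine ⟨!₂[b₂, 0], ?_, ?_⟩
        · simp only [ellipseRegion, Set.mem_ofPred_eq]
          simp
          rw [div_lt_one (by positivity)]
          gcongr
        · simp [EuclideanSpace.norm_eq, Fin.sum_univ_two, min_eq_right h.le, h₂.le]
    have hring := lt_dist_sq_of_mem_criticalSet h₁ h₂ ha hac hball hy₀ hf hu hnc hf0 hp
    have h1 := hx 1 (by norm_num)
    have h2 := hx (-1) (by norm_num)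
    have h3 := hy 1 (by norm_num)
    have h4 := hy (-1) (by norm_num)
    refine ⟨⟨⟨by linarith, by linarith⟩, ⟨by linarith, by linarith⟩⟩, hp.1,
      notMem_roundRing_of_lt_dist_sq ha.le (lt_of_le_of_lt ?_ hring)⟩
    exact mul_le_mul_of_nonneg_left (inradius_ellipseRegion_le h₁ h₂) ha.le
  · have hR : 0 < R := by linarith
    have e : eccentricAnnulus a r R = perforatedEllipse R R !₂[a, 0] r := by
      rw [eccentricAnnulus, perforatedEllipse, ball_eq_ellipseRegion hR]
    rw [e] at hu hnc hf0 hp ⊢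
    have hrc : r < R - a := by linarith
    have hball : Metric.ball !₂[a, 0] (R - a) ⊆ ellipseRegion R R := by
      rw [← ball_eq_ellipseRegion hR]
      refine Metric.ball_subset_ball' ?_
      simp [EuclideanSpace.norm_eq, Fin.sum_univ_two, ha.le]
    have h1 : p 0 < (a + r + R) / 2 := by
      have := inner_lt_of_mem_criticalSet (n := !₂[1, 0]) (B := R) hR hR hr hrc hball
        (by simp) (Or.inl ⟨by simp, rfl⟩)
        (by simp [PiLp.inner_apply, Fin.sum_univ_two]; positivity) hf hu hnc hf0 hp
      simp [PiLp.inner_apply, Fin.sum_univ_two] at this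
      linarith
    have h2 : (-R + a - r) / 2 < p 0 := by
      have := inner_lt_of_mem_criticalSet (n := !₂[-1, 0]) (B := R) hR hR hr hrc hball
        (by simp) (Or.inl ⟨by simp, rfl⟩)
        (by simp [PiLp.inner_apply, Fin.sum_univ_two]; linarith) hf hu hnc hf0 hp
      simp [PiLp.inner_apply, Fin.sum_univ_two] at this
      linarith
    have hpR : ‖p‖ < R := by
      have := hp.1.1
      rwa [← ball_eq_ellipseRegion hR, mem_ball_zero_iff] at this
    have h3 := abs_lt.1 ((PiLp.norm_apply_le p 1).trans_lt hpR)
    -- the disc of radius `R - a` about the hole touches the outer circle at `(R, 0)` only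
    have hring := lt_dist_sq_of_mem_criticalSet hR hR hr hrc hball
      ⟨!₂[a - (R - a), 0], by
        rw [← ball_eq_ellipseRegion hR, mem_ball_zero_iff]
        simp [EuclideanSpace.norm_eq, Fin.sum_univ_two, Real.sqrt_sq_eq_abs]
        rw [abs_lt]
        exact ⟨by linarith, by linarith⟩, by
        rw [dist_eq_norm]
        simp [EuclideanSpace.norm_eq, Fin.sum_univ_two, Real.sqrt_sq_eq_abs]
        rw [abs_sub_comm]
        ring_nf
        rw [abs_of_pos (by linarith)]⟩ hf hu hnc hf0 hp
    exact ⟨⟨⟨h2, h1⟩, h3⟩, hp.1, notMem_roundRing_of_lt_dist_sq hr.le hring⟩
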